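/- Conventions. $\mathbb N=\{0,1,2,\dots\}$, $\mathbb N^*=\mathbb N\setminus\{0\}$; Banach spaces are real. A Banach space $X$ is uniformly convex with modulus $\eta:(0,2]\to(0,1]$ if $\left\|\frac{x+y}2\right\|\le 1-\eta(\varepsilon)$ whenever $\varepsilon\in(0,2]$, $\|x\|,\|y\|\le 1$ and $\|x-y\|\ge\varepsilon$. It is uniformly smooth with modulus $\tau:(0,\infty)\to(0,\infty)$ if $\|x+y\|+\|x-y\|\le 2+\varepsilon\|y\|$ whenever $\varepsilon>0$, $\|x\|=1$ and $\|y\|\le\tau(\varepsilon)$. A map $T:C\to C$ is a pseudocontraction if $t\|x-y\|\le\|(t+1)(x-y)-(Tx-Ty)\|$ for all $x,y\in C$ and $t>0$. An operator $A\subseteq X\times X$ is accretive if $\|x_1-x_2\|\le\|x_1-x_2+\lambda(y_1-y_2)\|$ for all $\lambda>0$ and $(x_1,y_1),(x_2,y_2)\in A$; then $J_{\lambda A}y$ is the unique $z$ (if there is one) such that $z+\lambda w=y$ for some $w$ with $(z,w)\in A$, and it exists exactly for $y\in \mathrm{ran}(Id+\lambda A)$. **Theorem.** There is a functional $(b,\eta,\tau,\alpha,\gamma,\varepsilon,g)\mapsto\Theta_{b,\eta,\tau,\alpha,\gamma}(\varepsilon,g)\in\mathbb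 N$, depending only on the displayed arguments and definable in them by a closed term of Gödel's system T (typed $\lambda$-terms with recursors in all finite types, over the base types $\mathbb N$ and $\mathbb R$, with the embedding $\mathbb N\to\mathbb R$, the arithmetic operations and the minimum on $\mathbb R$, and the rounding up of reals to natural numbers as further constants), with the following two properties. (i) ($\Theta$ is a rate of metastability for resolvents of accretive operators.) Let $X$ be a Banach space which is uniformly convex with modulus $\eta$ and uniformly smooth with modulus $\tau$, let $C\subseteq X$ be closed, convex and nonempty, with diameter bounded by $b\in\mathbb N^*$, and let $A\subseteq X\times X$ be accretive such that for all $\lambda>0$ we have $C\subseteq \mathrm{ran}(Id+\lambda A)$ and $J_{\lambda A}y\in C$ for all $y\in C$. Let $x\in C$, $(\lambda_n)\subseteq(0,\infty)$, $\alpha:\mathbb N\to\mathbb N$ and $\gamma:\mathbb N\to\mathbb N^*$ be such that $\lambda_m\ge n+1$ for all $n$ and all $m\ge\alpha(n)$, and $\lambda_n\le\gamma(n)$ for all $n$. Then for all $\varepsilon>0$ and $g:\mathbb N\to\mathbb N$ there is an $N\le\Theta_{b,\eta,\tau,\alpha,\gamma}(\varepsilon,g)$ such that $\|J_{\lambda_mA}x-J_{\lambda_nA}x\|\le\varepsilon$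 for all $m,n\in[N,N+g(N)]$. (ii) (The same rate for pseudocontractions with a fixed point.) Put $\xi'(n):=\xi(n+1)$ and $\widetilde\Theta_{b,\eta,\tau,\xi,\gamma}:=\Theta_{b,\eta,\tau,\xi',\gamma}$. Let $X$ be a Banach space which is uniformly convex with modulus $\eta$ and uniformly smooth with modulus $\tau$, let $C\subseteq X$ be closed, convex and nonempty (not necessarily bounded), let $T:C\to C$ be a continuous pseudocontraction and $x\in C$. For all $t\in(0,1)$, let $x_t\in C$ be such that $x_t=tTx_t+(1-t)x$. Let $p\in C$ be a fixed point of $T$ and $b\in\mathbb N^*$ be such that $\|x-p\|\le b/2$. Let $(t_n)\subseteq(0,1)$, $\xi:\mathbb N\to\mathbb N$ and $\gamma:\mathbb N\to\mathbb N^*$ be such that $t_m\ge 1-\frac1{n+1}$ for all $n$ and all $m\ge\xi(n)$, and $t_n\le 1-\frac1{\gamma(n)}$ for all $n$. Then for all $\varepsilon>0$ and $g:\mathbb N\to\mathbb N$ there is an $N\le\widetilde\Theta_{b,\eta,\tau,\xi,\gamma}(\varepsilon,g)$ such that $\|x_{t_m}-x_{t_n}\|\le\varepsilon$ for all $m,n\in[N,N+g(N)]$.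 -/

import Mathlib

/-! Gödel's system T over the two base types `ℕ` and `ℝ`: finite types, typed lambda terms and their
standard (full set-theoretic) meaning. It is used to say that a functional is given explicitly, by a
closed expression in its arguments built with primitive recursion in all finite types. -/

universe u

namespace GodelT

/-- The finite types over the base types `nat` and `real`. -/
inductive Ty : Type
  | nat : Ty
  | real : Ty
  | arrow : Ty → Ty → Ty

/-- The full set-theoretic model. -/
def Ty.Interp : Ty → Type
  | .nat => ℕ
  | .real => ℝ
  | .arrow σ ρ => σ.Interp → ρ.Interp

/-- The constants: zero, successor and a recursor for every finite type; the embedding of `ℕ` into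
`ℝ`, the field operations of `ℝ`, the minimum of two reals, and the rounding up of a real number to a
natural number. In particular the only real constants available are those generated by these. -/
inductive Const : Ty → Type
  | zero : Const .nat
  | succ : Const (.arrow .nat .nat)
  | natRec (σ : Ty) : Const (.arrow σ (.arrow (.arrow .nat (.arrow σ σ)) (.arrow .nat σ)))
  | cast : Const (.arrow .nat .real)
  | add : Const (.arrow .real (.arrow .real .real))
  | sub : Const (.arrow .real (.arrow .real .real))
  | mul : Const (.arrow .real (.arrow .real .real))
  | inv : Const (.arrow .real .real)
  | min : Const (.arrow .real (.arrow .real .real))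
  | ceil : Const (.arrow .real .nat)

/-- Primitive recursion: `recursor a f 0 = a` and `recursor a f (n + 1) = f n (recursor a f n)`. -/
def recursor {α : Type} (a : α) (f : ℕ → α → α) : ℕ → α
  | 0 => a
  | n + 1 => f n (recursor a f n)

/-- The meaning of the constants. By convention the inverse of `0` is `0`, and the rounding up of a
negative real is `0`. -/
noncomputable def Const.eval : {σ : Ty} → Const σ → σ.Interp
  | _, .zero => (0 : ℕ)
  | _, .succ => fun n : ℕ => (n + 1 : ℕ)
  | _, .natRec σ => fun (a : σ.Interp) (f : ℕ → σ.Interp → σ.Interp) (n : ℕ) => recursor a f n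
  | _, .cast => fun n : ℕ => (n : ℝ)
  | _, .add => fun a b : ℝ => (a + b : ℝ)
  | _, .sub => fun a b : ℝ => (a - b : ℝ)
  | _, .mul => fun a b : ℝ => (a * b : ℝ)
  | _, .inv => fun a : ℝ => (a⁻¹ : ℝ)
  | _, .min => fun a b : ℝ => (Min.min a b : ℝ)
  | _, .ceil => fun a : ℝ => (⌈a⌉₊ : ℕ)

/-- `Var Γ σ`: the variables of type `σ` in the context `Γ` (de Bruijn indices). -/
inductive Var : List Ty → Ty → Type
  | here {Γ : List Ty} {σ : Ty} : Var (σ :: Γ) σ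
  | there {Γ : List Ty} {σ ρ : Ty} : Var Γ σ → Var (ρ :: Γ) σ

/-- `Term Γ σ`: the terms of type `σ` whose free variables are declared in `Γ`. -/
inductive Term : List Ty → Ty → Type
  | var {Γ : List Ty} {σ : Ty} : Var Γ σ → Term Γ σ
  | const {Γ : List Ty} {σ : Ty} : Const σ → Term Γ σ
  | app {Γ : List Ty} {σ ρ : Ty} : Term Γ (.arrow σ ρ) → Term Γ σ → Term Γ ρ
  | lam {Γ : List Ty} {σ ρ : Ty} : Term (σ :: Γ) ρ → Term Γ (.arrow σ ρ)

/-- Assignments of values to the variables of a context. -/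
def Env (Γ : List Ty) : Type := (σ : Ty) → Var Γ σ → σ.Interp

/-- The assignment on the empty context. -/
def Env.nil : Env [] := fun _ v => nomatch v

/-- Extension of an assignment by a value for a new variable. -/
def Env.cons {Γ : List Ty} {ρ : Ty} (a : ρ.Interp) (e : Env Γ) : Env (ρ :: Γ)
  | _, .here => a
  | σ, .there v => e σ v

/-- The meaning of a term under an assignment. -/
noncomputable def Term.evalIn : {Γ : List Ty} → {σ : Ty} → Term Γ σ → Env Γ → σ.Interp
  | _, _, .var v, e => e _ v
  | _, _, .const c, _ => c.eval
  | _, _, .app s t, e => (s.evalIn e) (t.evalIn e)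
  | _, _, .lam s, e => fun a => s.evalIn (Env.cons a e)

/-- The meaning of a closed term. -/
noncomputable def Term.eval {σ : Ty} (t : Term [] σ) : σ.Interp := t.evalIn Env.nil

end GodelT

/-- The functionals `Θ b η τ α γ ε g` with values in `ℕ`. -/
abbrev RateFunctional : Type :=
  ℕ → (ℝ → ℝ) → (ℝ → ℝ) → (ℕ → ℕ) → (ℕ → ℕ) → ℝ → (ℕ → ℕ) → ℕ

open GodelT.Ty in
/-- The finite type of such functionals. -/
abbrev rateTy : GodelT.Ty :=
  arrow nat (arrow (arrow real real) (arrow (arrow real real) (arrow (arrow nat nat)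
    (arrow (arrow nat nat) (arrow real (arrow (arrow nat nat) nat))))))

/-- `Θ` is definable in system T: it is the meaning of a closed term. -/
def TDefinable (Θ : RateFunctional) : Prop :=
  ∃ t : GodelT.Term [] rateTy, t.eval = Θ

section Geometry

variable {X : Type*} [NormedAddCommGroup X] [NormedSpace ℝ X]

/-- `η : (0,2] → (0,1]` is a modulus of uniform convexity of `X` (values of `η` off `(0,2]` are
irrelevant). -/
def IsConvexityModulus (X : Type*) [NormedAddCommGroup X] [NormedSpace ℝ X] (η : ℝ → ℝ) : Prop :=
  (∀ ε ∈ Set.Ioc (0 : ℝ) 2, η ε ∈ Set.Ioc (0 : ℝ) 1) ∧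
    ∀ ε ∈ Set.Ioc (0 : ℝ) 2, ∀ x y : X, ‖x‖ ≤ 1 → ‖y‖ ≤ 1 → ε ≤ ‖x - y‖ →
      ‖(2 : ℝ)⁻¹ • (x + y)‖ ≤ 1 - η ε

/-- `τ : (0,∞) → (0,∞)` is a modulus of uniform smoothness of `X` (values of `τ` off `(0,∞)` are
irrelevant). -/
def IsSmoothnessModulus (X : Type*) [NormedAddCommGroup X] [NormedSpace ℝ X] (τ : ℝ → ℝ) : Prop :=
  (∀ ε : ℝ, 0 < ε → 0 < τ ε) ∧
    ∀ ε : ℝ, 0 < ε → ∀ x y : X, ‖x‖ = 1 → ‖y‖ ≤ τ ε → ‖x + y‖ + ‖x - y‖ ≤ 2 + ε * ‖y‖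

/-- The self-map `T` of `C` (given as the restriction of a map on `X`) is a pseudocontraction. -/
def IsPseudocontraction (C : Set X) (T : X → X) : Prop :=
  Set.MapsTo T C C ∧ ∀ x ∈ C, ∀ y ∈ C, ∀ t : ℝ, 0 < t →
    t * ‖x - y‖ ≤ ‖(t + 1) • (x - y) - (T x - T y)‖

/-- The set-valued operator `A ⊆ X × X` is accretive. -/
def IsAccretive (A : Set (X × X)) : Prop :=
  ∀ l : ℝ, 0 < l → ∀ u ∈ A, ∀ v ∈ A, ‖u.1 - v.1‖ ≤ ‖u.1 - v.1 + l • (u.2 - v.2)‖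

/-- `z = J_{lA} y`, as a relation: `y ∈ (Id + lA) z`. For `A` accretive and `l > 0`, there is at most
one such `z` for each `y`, and one exists exactly if `y` lies in the range of `Id + lA`. -/
def IsResolvent (A : Set (X × X)) (l : ℝ) (y z : X) : Prop :=
  ∃ w : X, (z, w) ∈ A ∧ z + l • w = y

/-- `B` bounds metastability of the sequence `u` with respect to `ε` and `g`. -/
def MetastableBy (u : ℕ → X) (ε : ℝ) (g : ℕ → ℕ) (B : ℕ) : Prop :=
  ∃ N ≤ B, ∀ m ∈ Set.Icc N (N + g N), ∀ n ∈ Set.Icc N (N + g N), ‖u m - u n‖ ≤ ε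

end Geometry

/-- `Θ` is a rate of metastability for the resolvents of accretive operators, on sets `C` of diameter
at most `b`, in all Banach spaces with the moduli `η` and `τ`, and along all sequences `(l n)` of
positive reals controlled by `α` and `γ`. -/
def IsResolventRate (Θ : RateFunctional) : Prop :=
  ∀ (X : Type u) [NormedAddCommGroup X] [NormedSpace ℝ X] [CompleteSpace X] (η τ : ℝ → ℝ),
    IsConvexityModulus X η → IsSmoothnessModulus X τ →
    ∀ C : Set X, IsClosed C → Convex ℝ C →
    ∀ b : ℕ, 0 < b → (∀ y ∈ C, ∀ z ∈ C, ‖y - z‖ ≤ b) →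
    ∀ A : Set (X × X), IsAccretive A →
    (∀ l : ℝ, 0 < l → ∀ y ∈ C, ∃ z, IsResolvent A l y z) →
    (∀ l : ℝ, 0 < l → ∀ y ∈ C, ∀ z, IsResolvent A l y z → z ∈ C) →
    ∀ x ∈ C, ∀ l : ℕ → ℝ, (∀ n, 0 < l n) →
    ∀ α γ : ℕ → ℕ, (∀ n, 0 < γ n) →
    (∀ n, ∀ m ≥ α n, (n : ℝ) + 1 ≤ l m) → (∀ n, l n ≤ γ n) →
    ∀ J : ℕ → X, (∀ n, IsResolvent A (l n) x (J n)) →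
    ∀ ε : ℝ, 0 < ε → ∀ g : ℕ → ℕ, MetastableBy J ε g (Θ b η τ α γ ε g)

/-- The rate `Θ̃` obtained from `Θ` by replacing `ξ` with `ξ' n = ξ (n + 1)`. -/
def RateFunctional.tilde (Θ : RateFunctional) : RateFunctional :=
  fun b η τ ξ γ ε g => Θ b η τ (fun n => ξ (n + 1)) γ ε g

/-! ### Quantitative smoothness and convexity of the squared norm -/

section NormInequalities

variable {X : Type*} [NormedAddCommGroup X] [NormedSpace ℝ X]

/-! Suppose that metastability fails at each of `2 ^ L` stages. This yields pairs of resolvents of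
`x`, each pair `ε`-separated, with indices growing by a large factor from stage to stage. For a
dyadic block of pairs, consider the mean squared distance to its members as a function on `C`. The
heart is `not_common_near_minimizer`: two consecutive blocks have no common near minimizer `y`. To
see this, let `z` be the resolvent at `y` with an index between those of the two blocks. It is
hardly farther than `y` from the later block, so by uniform convexity the midpoint of `y` and `z`
would do better there unless `z` is near `y`. By accretivity and uniform smoothness, moving `z`
slightly towards `x` lowers the mean of the earlier block by a definite amount, because separated
pairs keep this mean away from `0`. This contradicts near minimality of `y`.

Hence doubling a block raises the lower bound on its mean by a fixed `c`, whereas no mean at `x`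
exceeds `b ^ 2`. So `L` is bounded, and the beginning of the stage after the last one is the rate.

For a pseudocontraction take `A = Id - T` on `C`, so that `x_t` is the resolvent at `x` of index `t
/ (1 - t)`, and replace `C` by its intersection with the ball of radius `b / 2` about `p`. Existence
of resolvents is proved by continuation in the index (`IsPseudocontraction.exists_resolvent`). It
rests on zeros of strongly accretive maps, found by minimizing mean squared distances along Euler
trajectories. -/

/-- Uniform smoothness of the squared norm on bounded sets. -/
theorem IsSmoothnessModulus.sq_norm_sub_add_le {τ : ℝ → ℝ} (hτ : IsSmoothnessModulus X τ)
    {e κ q B : ℝ} (he : 0 < e) (hκ : 0 < κ) (hq : 0 ≤ q) (hqκ : q * B ≤ τ e * κ) {w v : X}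
    (hw : ‖w‖ ≤ B) (hv : ‖v‖ ≤ B) :
    ‖w - q • v‖ ^ 2 + ‖w + q • v‖ ^ 2 ≤
      2 * ‖w‖ ^ 2 + q * (2 * e * B ^ 2 + 4 * κ * B + 2 * q * B ^ 2) := by
  have hB : 0 ≤ B := (norm_nonneg _).trans hw
  have hqv : ‖q • v‖ ≤ q * B := by
    rw [norm_smul, Real.norm_of_nonneg hq]; gcongr
  have hqB : 0 ≤ q * B := by positivity
  have h1 : ‖w - q • v‖ ≤ ‖w‖ + q * B := (norm_sub_le _ _).trans (by gcongr)
  have h2 : ‖w + q • v‖ ≤ ‖w‖ + q * B := (norm_add_le _ _).trans (by gcongr)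
  have h3 : ‖w‖ - q * B ≤ ‖w - q • v‖ := by
    have := norm_sub_norm_le w (q • v); linarith
  have h4 : ‖w‖ - q * B ≤ ‖w + q • v‖ := by
    have := norm_sub_norm_le w (-(q • v)); rw [norm_neg, sub_neg_eq_add] at this; linarith
  set d := ‖w‖ with hd
  have hd0 : 0 ≤ d := norm_nonneg _
  -- Smoothness applies to `w` scaled to norm one, and `κ` keeps the scaled perturbation below `τ
  -- e`. For smaller `w` the triangle inequality suffices.
  rcases le_or_gt κ d with hdκ | hdκ
  · have hdpos : 0 < d := hκ.trans_le hdκ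
    have key := hτ.2 e he (d⁻¹ • w) (d⁻¹ • (q • v))
      (by rw [norm_smul, norm_inv, Real.norm_of_nonneg hd0]; exact inv_mul_cancel₀ hdpos.ne')
      (by
        rw [norm_smul, norm_inv, Real.norm_of_nonneg hd0, inv_mul_le_iff₀ hdpos]
        calc ‖q • v‖ ≤ τ e * κ := hqv.trans hqκ
          _ ≤ τ e * d := by have := (hτ.1 e he).le; gcongr
          _ = d * τ e := mul_comm _ _)
    rw [← smul_add, ← smul_sub, norm_smul, norm_smul, norm_smul, norm_inv,
      Real.norm_of_nonneg hd0] at key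
    have key' : ‖w + q • v‖ + ‖w - q • v‖ ≤ 2 * d + e * ‖q • v‖ := by
      have := mul_le_mul_of_nonneg_left key hd0
      field_simp at this
      linarith
    have hsum : ‖w + q • v‖ + ‖w - q • v‖ - 2 * d ≤ e * (q * B) := by
      have : e * ‖q • v‖ ≤ e * (q * B) := by gcongr
      linarith
    have h5 : (‖w + q • v‖ - d) ^ 2 ≤ (q * B) ^ 2 := sq_le_sq' (by linarith) (by linarith)
    have h6 : (‖w - q • v‖ - d) ^ 2 ≤ (q * B) ^ 2 := sq_le_sq' (by linarith) (by linarith)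
    have h7 : 2 * d * (‖w + q • v‖ + ‖w - q • v‖ - 2 * d) ≤ 2 * B * (e * (q * B)) := by
      calc _ ≤ 2 * d * (e * (q * B)) := by gcongr
        _ ≤ _ := by gcongr
    have : 0 ≤ q * (4 * κ * B) := by positivity
    nlinarith
  · have h5 : ‖w - q • v‖ ^ 2 ≤ (d + q * B) ^ 2 := by gcongr
    have h6 : ‖w + q • v‖ ^ 2 ≤ (d + q * B) ^ 2 := by gcongr
    have h7 : d * (q * B) ≤ κ * (q * B) := by gcongr
    have : 0 ≤ q * (2 * e * B ^ 2) := by positivity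
    nlinarith

/-- Uniform convexity of the squared norm on bounded sets. -/
theorem IsConvexityModulus.sq_norm_midpoint_le {η : ℝ → ℝ} (hη : IsConvexityModulus X η)
    {δ B : ℝ} (hδ : 0 < δ) (hδB : δ ≤ B) {a c : X} (ha : ‖a‖ ≤ B) (hc : ‖c‖ ≤ B)
    (hac : δ ≤ ‖a - c‖) :
    ‖(2 : ℝ)⁻¹ • (a + c)‖ ^ 2 ≤ (‖a‖ ^ 2 + ‖c‖ ^ 2) / 2 - (δ * η (δ / B)) ^ 2 / 256 := by
  wlog hle : ‖c‖ ≤ ‖a‖ generalizing a c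
  · have := this hc ha (by rwa [norm_sub_rev]) (le_of_not_ge hle)
    rwa [add_comm c a, add_comm (‖c‖ ^ 2)] at this
  have hB : 0 < B := hδ.trans_le hδB
  have hmem : δ / B ∈ Set.Ioc (0 : ℝ) 2 :=
    ⟨by positivity, by rw [div_le_iff₀ hB]; linarith⟩
  obtain ⟨hη0, hη1⟩ := hη.1 _ hmem
  set t := η (δ / B) with ht
  set r := ‖a‖ with hr
  have hr2 : δ / 2 ≤ r := by
    have := norm_sub_le a c; linarith
  have hr0 : 0 < r := by linarith
  have key := hη.2 _ hmem (r⁻¹ • a) (r⁻¹ • c)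
    (by rw [norm_smul, norm_inv, Real.norm_of_nonneg hr0.le, inv_mul_cancel₀ hr0.ne'])
    (by rw [norm_smul, norm_inv, Real.norm_of_nonneg hr0.le, inv_mul_le_iff₀ hr0]; linarith)
    (by
      rw [← smul_sub, norm_smul, norm_inv, Real.norm_of_nonneg hr0.le, inv_mul_eq_div]
      gcongr)
  rw [← smul_add, smul_comm, norm_smul, norm_inv, Real.norm_of_nonneg hr0.le,
    inv_mul_le_iff₀ hr0] at key
  set m := ‖(2 : ℝ)⁻¹ • (a + c)‖ with hm
  have hm0 : 0 ≤ m := norm_nonneg _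
  have hm2 : m ≤ (r + ‖c‖) / 2 := by
    rw [hm, norm_smul, norm_inv, Real.norm_of_nonneg zero_le_two]
    have := norm_add_le a c
    linarith
  have hc0 : 0 ≤ ‖c‖ := norm_nonneg _
  set s := ‖c‖ with hs
  have hδt : 0 < δ * t := by positivity
  -- If the norms differ noticeably, strict convexity of the scalar square gives the gain. Otherwise
  -- it comes from uniform convexity on the ball of radius `r`.
  rcases le_or_gt (δ * t / 8) (r - s) with h | h
  · have h1 : m ^ 2 ≤ ((r + s) / 2) ^ 2 := by gcongr
    have h2 : (δ * t / 8) ^ 2 ≤ (r - s) ^ 2 := by gcongr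
    nlinarith
  · have h1 : m ^ 2 ≤ r * (1 - t) * r := by
      calc m ^ 2 ≤ (r * (1 - t)) ^ 2 := by gcongr
        _ = r * (1 - t) * r * (1 - t) := by ring
        _ ≤ r * (1 - t) * r * 1 := by
          have : 0 ≤ 1 - t := by linarith
          gcongr; linarith
        _ = _ := by ring
    have h2 : r ^ 2 - r * (δ * t / 4) ≤ (r ^ 2 + s ^ 2) / 2 := by nlinarith
    have h3 : δ / 2 * t * r ≤ r * t * r := by gcongr
    have h4 : δ / 2 * (δ * t) ≤ r * (δ * t) := by gcongr
    have h5 : (δ * t) * (δ * t) ≤ δ * (δ * t) := by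
      gcongr; nlinarith
    nlinarith

end NormInequalities

/-! ### Dyadic means -/

/-- The mean of `f` over the block of length `2 ^ L` that starts at `s`. -/
noncomputable def dyadicMean (f : ℕ → ℝ) : ℕ → ℕ → ℝ
  | 0, s => f s
  | L + 1, s => (dyadicMean f L s + dyadicMean f L (s + 2 ^ L)) / 2

theorem dyadicMean_le_affine {f g h : ℕ → ℝ} {a a' k : ℝ} (L s : ℕ)
    (H : ∀ i, s ≤ i → i < s + 2 ^ L → f i ≤ a * g i + a' * h i + k) :
    dyadicMean f L s ≤ a * dyadicMean g L s + a' * dyadicMean h L s + k := by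
  induction L generalizing s with
  | zero => exact H s le_rfl (by simp)
  | succ L ih =>
    have h1 := ih s fun i hi hi' => H i hi (by rw [pow_succ]; omega)
    have h2 := ih (s + 2 ^ L) fun i hi hi' => H i (by omega) (by rw [pow_succ]; omega)
    simp only [dyadicMean]
    linarith

theorem dyadicMean_le_const {f : ℕ → ℝ} {k : ℝ} (L s : ℕ)
    (H : ∀ i, s ≤ i → i < s + 2 ^ L → f i ≤ k) : dyadicMean f L s ≤ k := by
  simpa using dyadicMean_le_affine (g := f) (h := f) (a := 0) (a' := 0) L s (by simpa using H)

/-! ### Resolvents of accretive operators and the block argument -/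

section Resolvents

variable {X : Type*} [NormedAddCommGroup X] [NormedSpace ℝ X]

/-- The pairs `(w, l⁻¹ • (x - w))` and `(z, k⁻¹ • (y - z))` lie in `A`. -/
theorem IsAccretive.norm_sub_le_of_isResolvent {A : Set (X × X)} (hA : IsAccretive A)
    {l k h : ℝ} (hl : 0 < l) (hk : 0 < k) (hh : 0 < h) {x y w z : X}
    (hw : IsResolvent A l x w) (hz : IsResolvent A k y z) :
    ‖w - z‖ ≤ ‖w - z + h • (l⁻¹ • (x - w) - k⁻¹ • (y - z))‖ := by
  obtain ⟨w', hw', rfl⟩ := hw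
  obtain ⟨z', hz', rfl⟩ := hz
  simpa [smul_smul, hl.ne', hk.ne'] using hA h hh _ hw' _ hz'

/-- The resolvent at `y` moves `y` closer to resolvents of a much larger index. -/
theorem IsAccretive.sq_norm_resolvent_sub_le {A : Set (X × X)} (hA : IsAccretive A)
    {l k M B : ℝ} (hk : 0 < k) (hM : 1 ≤ M) (hl : M * k ≤ l) {x y w z : X}
    (hw : IsResolvent A l x w) (hz : IsResolvent A k y z) (hxw : ‖x - w‖ ≤ B) (hwy : ‖w - y‖ ≤ B) :
    ‖w - z‖ ^ 2 ≤ ‖w - y‖ ^ 2 + 3 * B ^ 2 / M := by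
  have hM0 : 0 < M := by linarith
  have hl0 : 0 < l := lt_of_lt_of_le (by positivity) hl
  have hB : 0 ≤ B := (norm_nonneg _).trans hxw
  have h1 := hA.norm_sub_le_of_isResolvent hl0 hk hk hw hz
  -- The parameter `k` turns `z` back into `y`; what remains of `x - w` is small because `l` is much
  -- larger than `k`.
  have h2 : w - z + k • (l⁻¹ • (x - w) - k⁻¹ • (y - z)) = (w - y) + (k / l) • (x - w) := by
    rw [smul_sub, smul_smul, smul_smul, mul_inv_cancel₀ hk.ne', one_smul, div_eq_mul_inv]; abel
  have h3 : k / l ≤ 1 / M := by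
    rw [div_le_div_iff₀ hl0 hM0]; linarith
  have h4 : ‖w - z‖ ≤ ‖w - y‖ + B / M := by
    rw [h2] at h1
    refine h1.trans ((norm_add_le _ _).trans ?_)
    rw [norm_smul, Real.norm_of_nonneg (by positivity)]
    gcongr
    calc k / l * ‖x - w‖ ≤ 1 / M * B := by gcongr
      _ = B / M := by ring
  have hBM : B / M ≤ B := div_le_self hB hM
  have hBM0 : 0 ≤ B / M := by positivity
  calc ‖w - z‖ ^ 2 ≤ (‖w - y‖ + B / M) ^ 2 := by gcongr
    _ = ‖w - y‖ ^ 2 + 2 * ‖w - y‖ * (B / M) + B / M * (B / M) := by ring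
    _ ≤ ‖w - y‖ ^ 2 + 2 * B * (B / M) + B * (B / M) := by gcongr
    _ = _ := by ring

/-- Moving an approximate zero `z` towards `x` brings it closer to resolvents of `x`. -/
theorem IsAccretive.sq_norm_sub_shift_le {A : Set (X × X)} (hA : IsAccretive A) {τ : ℝ → ℝ}
    (hτ : IsSmoothnessModulus X τ) {e κ q B l k δ : ℝ} (he : 0 < e) (hκ : 0 < κ) (hq : 0 < q)
    (hq1 : q ≤ 1) (hqκ : q * B ≤ τ e * κ) (hl : 0 < l) (hlk : l ≤ k) {x y w z : X}
    (hw : IsResolvent A l x w) (hz : IsResolvent A k y z) (hwz : ‖w - z‖ ≤ B) (hxz : ‖x - z‖ ≤ B)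
    (hyz : ‖y - z‖ ≤ δ) (hδB : δ ≤ B) :
    ‖w - (z + q • (x - z))‖ ^ 2 ≤
      (1 - 2 * q) * ‖w - z‖ ^ 2 + q * (2 * e * B ^ 2 + 4 * κ * B + 2 * q * B ^ 2 + 5 * B * δ) := by
  have hk : 0 < k := hl.trans_le hlk
  have hδ : 0 ≤ δ := (norm_nonneg _).trans hyz
  have hB : 0 ≤ B := hδ.trans hδB
  have hs := hτ.sq_norm_sub_add_le he hκ hq.le hqκ hwz hxz
  -- After multiplication by `1 + q`, this parameter leaves exactly `q • (x - z)` and an error along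
  -- `y - z`. Thus the outward shift lengthens `w - z` by about the factor `1 + q`, and smoothness
  -- makes the inward shift shorten it correspondingly.
  have h1 := hA.norm_sub_le_of_isResolvent hl hk (h := q / (1 + q) * l) (by positivity) hw hz
  have h2 : (1 + q) • (w - z + (q / (1 + q) * l) • (l⁻¹ • (x - w) - k⁻¹ • (y - z))) =
      (w - z + q • (x - z)) - (q * (l / k)) • (y - z) := by
    have : 1 + q ≠ 0 := by positivity
    match_scalars <;> field_simp <;> ring
  have h3 : (1 + q) * ‖w - z‖ ≤ ‖w - z + q • (x - z)‖ + q * δ := by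
    calc (1 + q) * ‖w - z‖
        ≤ (1 + q) * ‖w - z + (q / (1 + q) * l) • (l⁻¹ • (x - w) - k⁻¹ • (y - z))‖ := by gcongr
      _ = ‖(w - z + q • (x - z)) - (q * (l / k)) • (y - z)‖ := by
        rw [← h2, norm_smul, Real.norm_of_nonneg (by positivity)]
      _ ≤ ‖w - z + q • (x - z)‖ + ‖(q * (l / k)) • (y - z)‖ := norm_sub_le _ _
      _ ≤ _ := by
        rw [norm_smul, Real.norm_of_nonneg (by positivity)]
        have : l / k ≤ 1 := by rw [div_le_one hk]; exact hlk
        gcongr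
        calc q * (l / k) ≤ q * 1 := by gcongr
          _ = q := mul_one q
  have h4 : ‖w - z + q • (x - z)‖ ≤ 2 * B := by
    refine (norm_add_le _ _).trans ?_
    rw [norm_smul, Real.norm_of_nonneg hq.le]
    have : q * ‖x - z‖ ≤ 1 * B := by gcongr
    linarith
  rw [← sub_sub]
  set a := ‖w - z + q • (x - z)‖
  set d := ‖w - z‖
  have ha : 0 ≤ a := norm_nonneg _
  have h5 : ((1 + q) * d) ^ 2 ≤ (a + q * δ) ^ 2 := by
    have : 0 ≤ d := norm_nonneg _
    gcongr
  have h6 : a * (q * δ) ≤ 2 * B * (q * δ) := by gcongr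
  have h7 : (q * δ) * (q * δ) ≤ (1 * B) * (q * δ) := by gcongr
  have h8 : 0 ≤ q ^ 2 * d ^ 2 := by positivity
  nlinarith

variable {η τ : ℝ → ℝ} {C : Set X} {A : Set (X × X)} {x : X} {B ε e κ q δ c M : ℝ}
  {u v : ℕ → X} {l l' Γ : ℕ → ℝ}

/-- No point of `C` nearly minimizes the mean squared distance to each of two consecutive blocks of
pairs of resolvents, if the pairs are `ε`-separated and the indices grow fast. -/
theorem not_common_near_minimizer (hη : IsConvexityModulus X η) (hτ : IsSmoothnessModulus X τ)
    (hC : Convex ℝ C) (hdiam : ∀ y ∈ C, ∀ z ∈ C, ‖y - z‖ ≤ B) (hA : IsAccretive A)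
    (hres : ∀ l : ℝ, 0 < l → ∀ y ∈ C, ∃ z ∈ C, IsResolvent A l y z) (hx : x ∈ C)
    (he : 0 < e) (hκ : 0 < κ) (hq : 0 < q) (hq1 : q ≤ 1) (hqκ : q * B ≤ τ e * κ)
    (hδ : 0 < δ) (hδB : δ ≤ B) (hM : 1 ≤ M) (hε : 0 < ε)
    (hgain : 2 * c + 3 * B ^ 2 / (2 * M) < (δ * η (δ / B)) ^ 2 / 256)
    (hdrop : 2 * c + 2 * B * δ +
      q * (2 * e * B ^ 2 + 4 * κ * B + 2 * q * B ^ 2 + 5 * B * δ) < q * ε ^ 2 / 2)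
    (hu : ∀ i, IsResolvent A (l i) x (u i)) (hv : ∀ i, IsResolvent A (l' i) x (v i))
    (huC : ∀ i, u i ∈ C) (hvC : ∀ i, v i ∈ C)
    (hl : ∀ i, 0 < l i) (hl' : ∀ i, 0 < l' i) (hlΓ : ∀ i, l i ≤ Γ i) (hlΓ' : ∀ i, l' i ≤ Γ i)
    (hΓl : ∀ i j, i < j → M * Γ i ≤ l j) (hΓl' : ∀ i j, i < j → M * Γ i ≤ l' j) (L s : ℕ)
    (huv : ∀ i, s ≤ i → i < s + 2 ^ L → ε ≤ ‖u i - v i‖) {y : X}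
    (hy : y ∈ C)
    (hmin : ∀ z ∈ C, dyadicMean (fun i => (‖u i - y‖ ^ 2 + ‖v i - y‖ ^ 2) / 2) L s ≤
      dyadicMean (fun i => (‖u i - z‖ ^ 2 + ‖v i - z‖ ^ 2) / 2) L s + 2 * c)
    (hmin' : ∀ z ∈ C, dyadicMean (fun i => (‖u i - y‖ ^ 2 + ‖v i - y‖ ^ 2) / 2) L (s + 2 ^ L) ≤
      dyadicMean (fun i => (‖u i - z‖ ^ 2 + ‖v i - z‖ ^ 2) / 2) L (s + 2 ^ L) + 2 * c) :
    False := by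
  have hpow : 0 < 2 ^ L := Nat.two_pow_pos L
  -- With `t` the last position of the earlier block, `Γ t` dominates all indices of that block and
  -- is far below those of the later one.
  obtain ⟨t, ht⟩ : ∃ t, t + 1 = s + 2 ^ L := ⟨s + 2 ^ L - 1, by omega⟩
  have hΓpos : ∀ i, 0 < Γ i := fun i => (hl i).trans_le (hlΓ i)
  have hΓmono : ∀ i ≤ t, Γ i ≤ Γ t := by
    intro i hi
    rcases hi.eq_or_lt with rfl | hi
    · exact le_rfl
    · calc Γ i = 1 * Γ i := (one_mul _).symm
        _ ≤ M * Γ i := by have := (hΓpos i).le; gcongr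
        _ ≤ l t := hΓl i t hi
        _ ≤ Γ t := hlΓ t
  obtain ⟨z, hz, hzr⟩ := hres (Γ t) (hΓpos t) y hy
  have hyz : ‖y - z‖ < δ := by
    by_contra! hge
    have hm : (2 : ℝ)⁻¹ • (y + z) ∈ C := by
      rw [smul_add]
      exact hC hy hz (by norm_num) (by norm_num) (by norm_num)
    have hmid : ∀ w ∈ C, ‖w - (2 : ℝ)⁻¹ • (y + z)‖ ^ 2 ≤
        (‖w - y‖ ^ 2 + ‖w - z‖ ^ 2) / 2 - (δ * η (δ / B)) ^ 2 / 256 := by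
      intro w hw
      have := hη.sq_norm_midpoint_le hδ hδB (hdiam w hw y hy) (hdiam w hw z hz)
        (by rwa [sub_sub_sub_cancel_left, norm_sub_rev])
      convert this using 3
      module
    have hclose : ∀ i, t < i →
        (‖u i - z‖ ^ 2 + ‖v i - z‖ ^ 2) / 2 ≤
          (‖u i - y‖ ^ 2 + ‖v i - y‖ ^ 2) / 2 + 3 * B ^ 2 / M := by
      intro i hi
      have h1 := hA.sq_norm_resolvent_sub_le (hΓpos t) hM (hΓl t i hi) (hu i) hzr
        (hdiam x hx _ (huC i)) (hdiam _ (huC i) y hy)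
      have h2 := hA.sq_norm_resolvent_sub_le (hΓpos t) hM (hΓl' t i hi) (hv i) hzr
        (hdiam x hx _ (hvC i)) (hdiam _ (hvC i) y hy)
      linarith
    have h1 := dyadicMean_le_affine (f := fun i => (‖u i - (2 : ℝ)⁻¹ • (y + z)‖ ^ 2 +
        ‖v i - (2 : ℝ)⁻¹ • (y + z)‖ ^ 2) / 2)
      (g := fun i => (‖u i - y‖ ^ 2 + ‖v i - y‖ ^ 2) / 2)
      (h := fun i => (‖u i - z‖ ^ 2 + ‖v i - z‖ ^ 2) / 2) (a := 1 / 2) (a' := 1 / 2)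
      (k := -((δ * η (δ / B)) ^ 2 / 256)) L (s + 2 ^ L)
      (fun i _ _ => by
        have h1 := hmid _ (huC i)
        have h2 := hmid _ (hvC i)
        linarith)
    have h2 := dyadicMean_le_affine (f := fun i => (‖u i - z‖ ^ 2 + ‖v i - z‖ ^ 2) / 2)
      (g := fun i => (‖u i - y‖ ^ 2 + ‖v i - y‖ ^ 2) / 2)
      (h := fun i => (‖u i - y‖ ^ 2 + ‖v i - y‖ ^ 2) / 2) (a := 1) (a' := 0)
      (k := 3 * B ^ 2 / M) L (s + 2 ^ L)
      (fun i hi _ => by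
        have := hclose i (by omega)
        linarith)
    have h3 := hmin' _ hm
    have h4 : 3 * B ^ 2 / (2 * M) = 3 * B ^ 2 / M / 2 := by rw [div_div, mul_comm M]
    linarith
  have hz' : z + q • (x - z) ∈ C := hC.add_smul_sub_mem hz hx ⟨hq.le, hq1⟩
  have h1 := dyadicMean_le_affine (f := fun i => (‖u i - (z + q • (x - z))‖ ^ 2 +
        ‖v i - (z + q • (x - z))‖ ^ 2) / 2)
      (g := fun i => (‖u i - z‖ ^ 2 + ‖v i - z‖ ^ 2) / 2)
      (h := fun i => (‖u i - z‖ ^ 2 + ‖v i - z‖ ^ 2) / 2) (a := 1 - 2 * q + 2 * q) (a' := 0)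
      (k := q * (2 * e * B ^ 2 + 4 * κ * B + 2 * q * B ^ 2 + 5 * B * δ) - q * ε ^ 2 / 2) L s
      (fun i hsi hi => by
        have hi' := hΓmono i (by omega)
        have h1 := hA.sq_norm_sub_shift_le hτ he hκ hq hq1 hqκ (hl i) ((hlΓ i).trans hi') (hu i)
          hzr (hdiam _ (huC i) z hz) (hdiam x hx z hz) hyz.le hδB
        have h2 := hA.sq_norm_sub_shift_le hτ he hκ hq hq1 hqκ (hl' i) ((hlΓ' i).trans hi') (hv i)
          hzr (hdiam _ (hvC i) z hz) (hdiam x hx z hz) hyz.le hδB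
        have h3 : ε ≤ ‖u i - z‖ + ‖v i - z‖ := by
          refine (huv i hsi hi).trans ?_
          have := norm_sub_le (u i - z) (v i - z)
          rwa [sub_sub_sub_cancel_right] at this
        -- This is where separation enters: the mean for each pair is at least `ε ^ 2 / 4`, so the
        -- factor `1 - 2 * q` gains at least `q * ε ^ 2 / 2`.
        have h4 : ε ^ 2 ≤ 2 * (‖u i - z‖ ^ 2 + ‖v i - z‖ ^ 2) := by
          have h5 : ε ^ 2 ≤ (‖u i - z‖ + ‖v i - z‖) ^ 2 := by gcongr
          nlinarith [sq_nonneg (‖u i - z‖ - ‖v i - z‖)]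
        have h5 := mul_le_mul_of_nonneg_left h4 hq.le
        linarith)
  have hnear : ∀ w ∈ C, ‖w - z‖ ^ 2 ≤ ‖w - y‖ ^ 2 + 2 * B * δ := by
    intro w hw
    have h1 := hdiam w hw z hz
    have h2 := hdiam w hw y hy
    have h3 : ‖w - z‖ ≤ ‖w - y‖ + δ := by
      have := norm_add_le (w - y) (y - z)
      rw [sub_add_sub_cancel] at this
      linarith
    have h4 : 0 ≤ ‖w - z‖ := norm_nonneg _
    have h5 : 0 ≤ ‖w - y‖ := norm_nonneg _
    have h6 : (‖w - z‖ - ‖w - y‖) * (‖w - z‖ + ‖w - y‖) ≤ δ * (‖w - z‖ + ‖w - y‖) := by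
      gcongr; linarith
    have h7 : δ * (‖w - z‖ + ‖w - y‖) ≤ δ * (B + B) := by gcongr
    nlinarith
  have h2 := dyadicMean_le_affine (f := fun i => (‖u i - z‖ ^ 2 + ‖v i - z‖ ^ 2) / 2)
      (g := fun i => (‖u i - y‖ ^ 2 + ‖v i - y‖ ^ 2) / 2)
      (h := fun i => (‖u i - y‖ ^ 2 + ‖v i - y‖ ^ 2) / 2) (a := 1) (a' := 0)
      (k := 2 * B * δ) L s
      (fun i _ _ => by
        have h1 := hnear _ (huC i)
        have h2 := hnear _ (hvC i)
        linarith)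
  have h3 := hmin _ hz'
  linarith

/-- Among sufficiently many pairs of resolvents with fast growing indices, one is `ε`-close. -/
theorem exists_norm_sub_lt_of_resolvents (hη : IsConvexityModulus X η)
    (hτ : IsSmoothnessModulus X τ)
    (hC : Convex ℝ C) (hdiam : ∀ y ∈ C, ∀ z ∈ C, ‖y - z‖ ≤ B) (hA : IsAccretive A)
    (hres : ∀ l : ℝ, 0 < l → ∀ y ∈ C, ∃ z ∈ C, IsResolvent A l y z) (hx : x ∈ C)
    (he : 0 < e) (hκ : 0 < κ) (hq : 0 < q) (hq1 : q ≤ 1) (hqκ : q * B ≤ τ e * κ)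
    (hδ : 0 < δ) (hδB : δ ≤ B) (hM : 1 ≤ M) (hε : 0 < ε)
    (hgain : 2 * c + 3 * B ^ 2 / (2 * M) < (δ * η (δ / B)) ^ 2 / 256)
    (hdrop : 2 * c + 2 * B * δ +
      q * (2 * e * B ^ 2 + 4 * κ * B + 2 * q * B ^ 2 + 5 * B * δ) < q * ε ^ 2 / 2)
    (hu : ∀ i, IsResolvent A (l i) x (u i)) (hv : ∀ i, IsResolvent A (l' i) x (v i))
    (huC : ∀ i, u i ∈ C) (hvC : ∀ i, v i ∈ C)
    (hl : ∀ i, 0 < l i) (hl' : ∀ i, 0 < l' i) (hlΓ : ∀ i, l i ≤ Γ i) (hlΓ' : ∀ i, l' i ≤ Γ i)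
    (hΓl : ∀ i j, i < j → M * Γ i ≤ l j) (hΓl' : ∀ i j, i < j → M * Γ i ≤ l' j) {L : ℕ}
    (hL : B ^ 2 < L * c) : ∃ i < 2 ^ L, ‖u i - v i‖ < ε := by
  by_contra! hfar
  -- Each doubling of the block adds `c` to the lower bound of the mean.
  have hmean : ∀ K s, s + 2 ^ K ≤ 2 ^ L → ∀ y ∈ C,
      K * c ≤ dyadicMean (fun i => (‖u i - y‖ ^ 2 + ‖v i - y‖ ^ 2) / 2) K s := by
    intro K
    induction K with
    | zero =>
      intro s _ y _
      simp only [dyadicMean, Nat.cast_zero, zero_mul]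
      positivity
    | succ K ih =>
      intro s hs y hy
      rw [pow_succ] at hs
      have h1 := ih s (by omega)
      have h2 := ih (s + 2 ^ K) (by omega)
      -- The halves at `y` sum to less than `2 * (K + 1) * c`, and each is at least `K * c`. So each
      -- is below `(K + 2) * c`, and `y` is a near minimizer of both with error `2 * c`.
      by_contra! hlt
      simp only [dyadicMean, Nat.cast_add, Nat.cast_one] at hlt
      have h3 := h1 y hy
      have h4 := h2 y hy
      refine not_common_near_minimizer hη hτ hC hdiam hA hres hx he hκ hq hq1 hqκ hδ hδB hM hε
        hgain hdrop hu hv huC hvC hl hl' hlΓ hlΓ' hΓl hΓl' K s (fun i _ hi => hfar i (by omega)) hy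
        (fun z hz => ?_) (fun z hz => ?_)
      · have := h1 z hz
        linarith
      · have := h2 z hz
        linarith
  have h1 := hmean L 0 (by simp) x hx
  have h2 := dyadicMean_le_const (f := fun i => (‖u i - x‖ ^ 2 + ‖v i - x‖ ^ 2) / 2)
    (k := B ^ 2) L 0 fun i _ _ => by
      have h3 : ‖u i - x‖ ^ 2 ≤ B ^ 2 := by
        have := hdiam _ (huC i) x hx
        gcongr
      have h4 : ‖v i - x‖ ^ 2 ≤ B ^ 2 := by
        have := hdiam _ (hvC i) x hx
        gcongr
      linarith
  linarith

end Resolvents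

/-! The rate: explicit constants and the recursion that generates the stages. -/

/-- Addition by primitive recursion. -/
def recAdd (m n : ℕ) : ℕ := GodelT.recursor m (fun _ s => s + 1) n

/-- Powers of two by primitive recursion. -/
def recTwoPow (n : ℕ) : ℕ := GodelT.recursor 1 (fun _ s => recAdd s s) n

/-- Bound on the smoothness error and on the length of the shift towards the anchor. -/
noncomputable def rateErr (b : ℕ) (ε : ℝ) : ℝ := ε * ε * ((recTwoPow 6 : ℝ) * ((b : ℝ) * b))⁻¹

/-- Distances below this threshold are ignored in the smoothness estimate. -/
noncomputable def rateThreshold (b : ℕ) (ε : ℝ) : ℝ := ε * ε * ((recTwoPow 7 : ℝ) * (b : ℝ))⁻¹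

/-- Length of the shift towards the anchor. -/
noncomputable def rateStep (b : ℕ) (τ : ℝ → ℝ) (ε : ℝ) : ℝ :=
  min (rateErr b ε) (τ (rateErr b ε) * rateThreshold b ε * (b : ℝ)⁻¹)

/-- Precision to which near minimizers are near zeros. -/
noncomputable def ratePrec (b : ℕ) (τ : ℝ → ℝ) (ε : ℝ) : ℝ :=
  rateStep b τ ε * (ε * ε) * ((recTwoPow 6 : ℝ) * (b : ℝ))⁻¹

/-- Gain of convexity at distance `ratePrec`. -/
noncomputable def rateGain (b : ℕ) (η τ : ℝ → ℝ) (ε : ℝ) : ℝ :=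
  (ratePrec b τ ε * η (ratePrec b τ ε * (b : ℝ)⁻¹)) *
    (ratePrec b τ ε * η (ratePrec b τ ε * (b : ℝ)⁻¹)) * (recTwoPow 8 : ℝ)⁻¹

/-- Logarithm of the number of stages; also the required quotient of the indices of consecutive
stages. -/
noncomputable def rateDepth (b : ℕ) (η τ : ℝ → ℝ) (ε : ℝ) : ℕ :=
  ⌈(recTwoPow 3 : ℝ) * ((b : ℝ) * b) * (rateGain b η τ ε)⁻¹⌉₊ + 1

/-- Multiplication by primitive recursion. -/
def recMul (m n : ℕ) : ℕ := GodelT.recursor 0 (fun _ s => recAdd s m) n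

/-- The sum `f 0 + ... + f n` by primitive recursion. -/
def recSum (f : ℕ → ℕ) (n : ℕ) : ℕ :=
  GodelT.recursor (f 0) (fun k s => recAdd s (f (k + 1))) n

/-- The beginnings of the stages. -/
def recStage (M : ℕ) (γ α g : ℕ → ℕ) (K : ℕ) : ℕ :=
  GodelT.recursor 0 (fun _ n => recAdd n (α (recMul M (recSum γ (recAdd n (g n)))))) K

theorem recAdd_eq (m n : ℕ) : recAdd m n = m + n := by
  induction n with
  | zero => rfl
  | succ n ih => exact congrArg (· + 1) ih

theorem recMul_eq (m n : ℕ) : recMul m n = m * n := by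
  induction n with
  | zero => rfl
  | succ n ih =>
    change recAdd (recMul m n) m = _
    rw [recAdd_eq, ih, Nat.mul_succ]

theorem recTwoPow_eq (n : ℕ) : recTwoPow n = 2 ^ n := by
  induction n with
  | zero => rfl
  | succ n ih =>
    change recAdd (recTwoPow n) (recTwoPow n) = _
    rw [recAdd_eq, ih, pow_succ, mul_two]

theorem le_recSum (f : ℕ → ℕ) {k n : ℕ} (hk : k ≤ n) : f k ≤ recSum f n := by
  induction n with
  | zero => obtain rfl : k = 0 := by omega
            exact le_rfl
  | succ n ih =>
    change f k ≤ recAdd (recSum f n) (f (n + 1))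
    rw [recAdd_eq]
    rcases hk.eq_or_lt with rfl | hk
    · omega
    · have := ih (by omega)
      omega

theorem recStage_succ (M : ℕ) (γ α g : ℕ → ℕ) (K : ℕ) :
    recStage M γ α g (K + 1) = recStage M γ α g K +
      α (M * recSum γ (recStage M γ α g K + g (recStage M γ α g K))) := by
  change recAdd (recStage M γ α g K) (α (recMul M (recSum γ (recAdd (recStage M γ α g K)
    (g (recStage M γ α g K)))))) = _
  simp only [recAdd_eq, recMul_eq]

theorem recStage_mono (M : ℕ) (γ α g : ℕ → ℕ) : Monotone (recStage M γ α g) :=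
  monotone_nat_of_le_succ fun K => by rw [recStage_succ]; exact Nat.le_add_right _ _

/-- The rate of metastability. -/
noncomputable def resolventRate : RateFunctional := fun b η τ α γ ε g =>
  recStage (rateDepth b η τ ε) γ α g (recTwoPow (rateDepth b η τ ε))

/-! ### Terms of system T that denote the rate -/

namespace GodelT

infixl:90 " ⬝ " => Term.app

open Ty Term

/-- Numerals. -/
def numeral {Γ : List Ty} : ℕ → Term Γ nat
  | 0 => const .zero
  | n + 1 => const .succ ⬝ numeral n

/-- Products of reals. -/
def mulTerm {Γ : List Ty} (s t : Term Γ real) : Term Γ real := const .mul ⬝ s ⬝ t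

/-- Inverses of reals. -/
def invTerm {Γ : List Ty} (s : Term Γ real) : Term Γ real := const .inv ⬝ s

/-- A term for `recAdd`. -/
def addTerm {Γ : List Ty} (s t : Term Γ nat) : Term Γ nat :=
  const (.natRec nat) ⬝ s ⬝ lam (lam (const .succ ⬝ var .here)) ⬝ t

/-- A term for `recMul`. -/
def recMulTerm {Γ : List Ty} : Term Γ (arrow nat (arrow nat nat)) :=
  lam (lam (const (.natRec nat) ⬝ const .zero ⬝
    lam (lam (addTerm (var .here) (var (.there (.there (.there .here)))))) ⬝ var .here))

/-- A term for `recTwoPow`. -/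
def recTwoPowTerm {Γ : List Ty} : Term Γ (arrow nat nat) :=
  lam (const (.natRec nat) ⬝ numeral 1 ⬝
    lam (lam (addTerm (var .here) (var .here))) ⬝ var .here)

/-- Powers of two as reals. -/
def twoPowReal {Γ : List Ty} (n : ℕ) : Term Γ real := const .cast ⬝ (recTwoPowTerm ⬝ numeral n)

/-- A term for `recSum`. -/
def recSumTerm {Γ : List Ty} : Term Γ (arrow (arrow nat nat) (arrow nat nat)) :=
  lam (lam (const (.natRec nat) ⬝ (var (.there .here) ⬝ const .zero) ⬝
    lam (lam (addTerm (var .here) (var (.there (.there (.there .here))) ⬝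
      (const .succ ⬝ var (.there .here))))) ⬝ var .here))

/-- A term for `recStage`. -/
def recStageTerm {Γ : List Ty} : Term Γ (arrow nat (arrow (arrow nat nat) (arrow (arrow nat nat)
    (arrow (arrow nat nat) (arrow nat nat))))) :=
  lam (lam (lam (lam (lam (const (.natRec nat) ⬝ const .zero ⬝
    lam (lam (addTerm (var .here)
      (var (.there (.there (.there (.there .here)))) ⬝
        (recMulTerm ⬝ var (.there (.there (.there (.there (.there (.there .here)))))) ⬝
          (recSumTerm ⬝ var (.there (.there (.there (.there (.there .here))))) ⬝
            addTerm (var .here) (var (.there (.there (.there .here))) ⬝ var .here)))))) ⬝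
      var .here)))))

/-- The context of the arguments of the rate. -/
abbrev rateCtx : List Ty :=
  [arrow nat nat, real, arrow nat nat, arrow nat nat, arrow real real, arrow real real, nat]

/-- The variable `g`. -/
def gTerm : Term rateCtx (arrow nat nat) := var .here

/-- The square of the variable `ε`. -/
def epsSqTerm : Term rateCtx real := mulTerm (var (.there .here)) (var (.there .here))

/-- The variable `γ`. -/
def gammaTerm : Term rateCtx (arrow nat nat) := var (.there (.there .here))

/-- The variable `α`. -/
def alphaTerm : Term rateCtx (arrow nat nat) := var (.there (.there (.there .here)))

/-- The variable `τ`. -/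
def tauTerm : Term rateCtx (arrow real real) := var (.there (.there (.there (.there .here))))

/-- The variable `η`. -/
def etaTerm : Term rateCtx (arrow real real) :=
  var (.there (.there (.there (.there (.there .here)))))

/-- The variable `b`, as a real. -/
def boundTerm : Term rateCtx real :=
  const .cast ⬝ var (.there (.there (.there (.there (.there (.there .here))))))

/-- A term for `rateErr`. -/
def errTerm : Term rateCtx real :=
  mulTerm epsSqTerm (invTerm (mulTerm (twoPowReal 6) (mulTerm boundTerm boundTerm)))

/-- A term for `rateThreshold`. -/
def thresholdTerm : Term rateCtx real :=
  mulTerm epsSqTerm (invTerm (mulTerm (twoPowReal 7) boundTerm))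

/-- A term for `rateStep`. -/
def stepTerm : Term rateCtx real :=
  const .min ⬝ errTerm ⬝ mulTerm (mulTerm (tauTerm ⬝ errTerm) thresholdTerm) (invTerm boundTerm)

/-- A term for `ratePrec`. -/
def precTerm : Term rateCtx real :=
  mulTerm (mulTerm stepTerm epsSqTerm) (invTerm (mulTerm (twoPowReal 6) boundTerm))

/-- A term for the square root of a multiple of `rateGain`. -/
def precEtaTerm : Term rateCtx real :=
  mulTerm precTerm (etaTerm ⬝ mulTerm precTerm (invTerm boundTerm))

/-- A term for `rateGain`. -/
def gainTerm : Term rateCtx real :=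
  mulTerm (mulTerm precEtaTerm precEtaTerm) (invTerm (twoPowReal 8))

/-- A term for `rateDepth`. -/
def depthTerm : Term rateCtx nat :=
  const .succ ⬝ (const .ceil ⬝
    mulTerm (mulTerm (twoPowReal 3) (mulTerm boundTerm boundTerm)) (invTerm gainTerm))

/-- A term for the rate, in context. -/
def rateTerm : Term rateCtx nat :=
  recStageTerm ⬝ depthTerm ⬝ gammaTerm ⬝ alphaTerm ⬝ gTerm ⬝ (recTwoPowTerm ⬝ depthTerm)

end GodelT

/-- The rate is built from `recursor` in the same pattern as the term, so evaluation unfolds to it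
definitionally. -/
theorem tDefinable_resolventRate : TDefinable resolventRate :=
  ⟨.lam (.lam (.lam (.lam (.lam (.lam (.lam GodelT.rateTerm)))))), rfl⟩

/-! ### Verification of the rate -/

/-- With `c = ψ / 8`, every error term in the drop inequality is at most `5 / 64` of `q * ε ^ 2`.
Since `D * ψ > 8 * B ^ 2`, the number `D` can serve both as growth factor `M` and as depth `L`. -/
theorem rate_constants_aux {η τ : ℝ → ℝ} {B ε e κ q δ ψ D : ℝ}
    (hη : ∀ t ∈ Set.Ioc (0 : ℝ) 2, η t ∈ Set.Ioc (0 : ℝ) 1) (hτe : 0 < τ e) (hε : 0 < ε)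
    (hB : 0 < B) (hεb : ε < B) (heq : 64 * e * B ^ 2 = ε ^ 2) (hκeq : 128 * κ * B = ε ^ 2)
    (he : 0 < e) (hκ : 0 < κ) (hqdef : q = min e (τ e * κ * B⁻¹))
    (hδeq : 64 * B * δ = q * ε ^ 2) (hψdef : ψ = (δ * η (δ / B)) ^ 2 / 256)
    (hDdef : D = ⌈8 * (B * B) * ψ⁻¹⌉₊ + 1) :
    0 < q ∧ q ≤ 1 ∧ q * B ≤ τ e * κ ∧ 0 < δ ∧ δ ≤ B ∧
      2 * (ψ / 8) + 3 * B ^ 2 / (2 * D) < (δ * η (δ / B)) ^ 2 / 256 ∧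
      2 * (ψ / 8) + 2 * B * δ + q * (2 * e * B ^ 2 + 4 * κ * B + 2 * q * B ^ 2 + 5 * B * δ) <
        q * ε ^ 2 / 2 ∧
      B ^ 2 < D * (ψ / 8) := by
  have hεB : ε ^ 2 ≤ B ^ 2 := by gcongr
  have hq : 0 < q := by rw [hqdef]; positivity
  have hqe : q ≤ e := by rw [hqdef]; exact min_le_left _ _
  have he1 : e ≤ 1 / 64 := by
    by_contra! h
    have : 1 / 64 * B ^ 2 < e * B ^ 2 := by gcongr
    linarith
  have hqκ : q * B ≤ τ e * κ := by
    have : q ≤ τ e * κ * B⁻¹ := by rw [hqdef]; exact min_le_right _ _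
    calc q * B ≤ τ e * κ * B⁻¹ * B := by gcongr
      _ = τ e * κ := by field_simp
  have hδ : 0 < δ := by
    have : 0 < 64 * B * δ := by rw [hδeq]; positivity
    exact pos_of_mul_pos_right this (by positivity)
  have hδB : δ ≤ B := by
    have h1 : q * ε ^ 2 ≤ 1 * B ^ 2 := by gcongr; linarith
    have h2 : B * δ ≤ B * B := by nlinarith
    exact le_of_mul_le_mul_left h2 hB
  have hmem : δ / B ∈ Set.Ioc (0 : ℝ) 2 :=
    ⟨by positivity, by rw [div_le_iff₀ hB]; linarith⟩
  obtain ⟨hη0, hη1⟩ := hη _ hmem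
  have hψ : 0 < ψ := by rw [hψdef]; positivity
  have hψδ : ψ ≤ B * δ / 256 := by
    rw [hψdef]
    have h1 : (δ * η (δ / B)) ^ 2 ≤ (δ * 1) ^ 2 := by gcongr
    have h2 : δ * δ ≤ B * δ := by gcongr
    linarith
  have hD : 8 * B ^ 2 / ψ + 1 ≤ D := by
    rw [hDdef]
    have := Nat.le_ceil (8 * (B * B) * ψ⁻¹)
    calc 8 * B ^ 2 / ψ + 1 = 8 * (B * B) * ψ⁻¹ + 1 := by ring
      _ ≤ _ := by gcongr
  have hDψ : 8 * B ^ 2 < D * ψ := by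
    have : 8 * B ^ 2 / ψ < D := by linarith
    rwa [div_lt_iff₀ hψ] at this
  have hD0 : 0 < D := by
    have : 0 < 8 * B ^ 2 / ψ := by positivity
    linarith
  refine ⟨hq, by linarith, hqκ, hδ, hδB, ?_, ?_, ?_⟩
  · rw [← hψdef]
    have : 3 * B ^ 2 / (2 * D) ≤ ψ / 4 := by
      rw [div_le_iff₀ (by positivity)]
      nlinarith
    linarith
  · have h1 : q * (e * B ^ 2) = q * ε ^ 2 / 64 := by rw [← heq]; ring
    have h2 : q * (κ * B) = q * ε ^ 2 / 128 := by rw [← hκeq]; ring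
    have h3 : q * (q * B ^ 2) ≤ q * (e * B ^ 2) := by gcongr
    have h4 : q * (B * δ) ≤ 1 * (B * δ) := by gcongr; linarith
    have h5 : 0 < q * ε ^ 2 := by positivity
    nlinarith
  · linarith

theorem exists_rate_constants {X : Type*} [NormedAddCommGroup X] [NormedSpace ℝ X] {η τ : ℝ → ℝ}
    (hη : IsConvexityModulus X η) (hτ : IsSmoothnessModulus X τ) {b : ℕ} {ε : ℝ} (hε : 0 < ε)
    (hεb : ε < b) :
    ∃ e κ q δ c : ℝ, 0 < e ∧ 0 < κ ∧ 0 < q ∧ q ≤ 1 ∧ q * b ≤ τ e * κ ∧ 0 < δ ∧ δ ≤ b ∧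
      2 * c + 3 * (b : ℝ) ^ 2 / (2 * (rateDepth b η τ ε : ℝ)) <
        (δ * η (δ / b)) ^ 2 / 256 ∧
      2 * c + 2 * b * δ + q * (2 * e * b ^ 2 + 4 * κ * b + 2 * q * b ^ 2 + 5 * b * δ) <
        q * ε ^ 2 / 2 ∧
      (b : ℝ) ^ 2 < rateDepth b η τ ε * c := by
  have hB : (0 : ℝ) < b := hε.trans hεb
  have h64 : (recTwoPow 6 : ℝ) = 64 := by rw [recTwoPow_eq]; norm_num
  have h128 : (recTwoPow 7 : ℝ) = 128 := by rw [recTwoPow_eq]; norm_num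
  have h256 : (recTwoPow 8 : ℝ) = 256 := by rw [recTwoPow_eq]; norm_num
  have h8 : (recTwoPow 3 : ℝ) = 8 := by rw [recTwoPow_eq]; norm_num
  have heq : 64 * rateErr b ε * b ^ 2 = ε ^ 2 := by
    rw [rateErr, h64]; field_simp
  have hκeq : 128 * rateThreshold b ε * b = ε ^ 2 := by
    rw [rateThreshold, h128]; field_simp
  have he : 0 < rateErr b ε := by
    rw [rateErr, h64]; positivity
  have hκ : 0 < rateThreshold b ε := by
    rw [rateThreshold, h128]; positivity
  have hqdef : rateStep b τ ε =
    min (rateErr b ε) (τ (rateErr b ε) * rateThreshold b ε * (b : ℝ)⁻¹) := rfl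
  have hδeq : 64 * b * ratePrec b τ ε = rateStep b τ ε * ε ^ 2 := by
    rw [ratePrec, h64]; field_simp
  have hψdef : rateGain b η τ ε =
      (ratePrec b τ ε * η (ratePrec b τ ε / b)) ^ 2 / 256 := by
    rw [rateGain, h256]; ring_nf
  have hDdef : (rateDepth b η τ ε : ℝ) = ⌈8 * ((b : ℝ) * b) * (rateGain b η τ ε)⁻¹⌉₊ + 1 := by
    rw [rateDepth, h8]; push_cast; rfl
  exact ⟨_, _, _, _, _, he, hκ, rate_constants_aux hη.1 (hτ.1 _ he) hε hB hεb heq hκeq he hκ hqdef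
    hδeq hψdef hDdef⟩

theorem isResolventRate_resolventRate : IsResolventRate.{u} resolventRate := by
  intro X _ _ _ η τ hη hτ C _ hC b _ hdiam A hA hex hmaps x hx l hl α γ hγ hα hlγ J hJ ε hε g
  by_contra hmeta
  simp only [MetastableBy, not_exists, not_and, not_forall, not_le] at hmeta
  have hJC : ∀ n, J n ∈ C := fun n => hmaps (l n) (hl n) x hx _ (hJ n)
  set D := rateDepth b η τ ε with hD
  set N := recStage D γ α g with hN
  have hNmono : Monotone N := recStage_mono D γ α g
  have hΘ : resolventRate b η τ α γ ε g = N (2 ^ D) := by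
    rw [← recTwoPow_eq]; rfl
  -- Stages from `2 ^ D` on get a dummy pair, so that the sequences of pairs are total.
  have hpair : ∀ i, ∃ m ∈ Set.Icc (N i) (N i + g (N i)), ∃ n ∈ Set.Icc (N i) (N i + g (N i)),
      i < 2 ^ D → ε < ‖J m - J n‖ := by
    intro i
    by_cases hi : i < 2 ^ D
    · obtain ⟨m, hm, n, hn, h⟩ := hmeta (N i) (by rw [hΘ]; exact hNmono hi.le)
      exact ⟨m, hm, n, hn, fun _ => h⟩
    · exact ⟨N i, by simp, N i, by simp, fun h => absurd h hi⟩
  choose m hm n hn hmn using hpair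
  -- The failure of metastability itself excludes large `ε`, for which the constants would not work.
  have hεb : ε < b := (hmn 0 (Nat.two_pow_pos D)).trans_le (hdiam _ (hJC _) _ (hJC _))
  obtain ⟨e, κ, q, δ, c, he, hκ, hq, hq1, hqκ, hδ, hδB, hgain, hdrop, hc⟩ :=
    exists_rate_constants hη hτ hε hεb
  have hD1 : (1 : ℝ) ≤ D := Nat.one_le_cast.mpr (Nat.le_add_left 1 _)
  -- The sum serves as a primitive recursive bound for all `γ k` in the window.
  set Γ : ℕ → ℝ := fun i => (recSum γ (N i + g (N i)) : ℝ) with hΓ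
  have hup : ∀ i, ∀ k ∈ Set.Icc (N i) (N i + g (N i)), l k ≤ Γ i := fun i k hk =>
    (hlγ k).trans (Nat.cast_le.mpr (le_recSum γ hk.2))
  have hlow : ∀ i j, i < j → ∀ k ∈ Set.Icc (N j) (N j + g (N j)), (D : ℝ) * Γ i ≤ l k := by
    intro i j hij k hk
    have h1 : N (i + 1) = N i + α (D * recSum γ (N i + g (N i))) := recStage_succ D γ α g i
    have h2 : α (D * recSum γ (N i + g (N i))) ≤ k := by
      have := hNmono (Nat.succ_le_of_lt hij)
      have := hk.1
      simp only [Nat.succ_eq_add_one] at *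
      omega
    have h3 := hα _ k h2
    push_cast at h3
    linarith
  obtain ⟨i, hi, hlt⟩ := exists_norm_sub_lt_of_resolvents (u := fun i => J (m i))
    (v := fun i => J (n i)) (l := fun i => l (m i)) (l' := fun i => l (n i)) (Γ := Γ)
    hη hτ hC hdiam hA
    (fun k hk y hy => (hex k hk y hy).imp fun z hz => ⟨hmaps k hk y hy z hz, hz⟩) hx he hκ hq hq1
    hqκ hδ hδB hD1 hε hgain hdrop (fun i => hJ _) (fun i => hJ _) (fun i => hJC _) (fun i => hJC _)
    (fun i => hl _) (fun i => hl _) (fun i => hup i _ (hm i)) (fun i => hup i _ (hn i))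
    (fun i j hij => hlow i j hij _ (hm j)) (fun i j hij => hlow i j hij _ (hn j)) hc
  exact absurd hlt (hmn i hi).le.not_gt

/-! ### Euler trajectories of strongly accretive maps -/

section Zeros

open Filter Topology

variable {X : Type*} [NormedAddCommGroup X] [NormedSpace ℝ X] {C : Set X} {G : X → X}

theorem sub_smul_mem_of_le (hC : Convex ℝ C) {θ h : ℝ} (hθ : 0 < θ) (hh : 0 ≤ h) (hhθ : h ≤ θ)
    {u v : X} (hu : u ∈ C) (huv : u - θ • v ∈ C) : u - h • v ∈ C := by
  have h1 := hC.add_smul_sub_mem hu huv (t := h / θ)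
    ⟨by positivity, by rw [div_le_one hθ]; exact hhθ⟩
  have h2 : u + (h / θ) • (u - θ • v - u) = u - h • v := by
    match_scalars <;> field_simp
    ring
  rwa [h2] at h1

/-- Steps of the explicit Euler scheme along which `G` varies little, of nearly maximal length. -/
theorem exists_greedy_step (hC : Convex ℝ C) (hG : ContinuousOn G C) {θ δ : ℝ}
    (hθ : 0 < θ) (hin : ∀ u ∈ C, u - θ • G u ∈ C) (hδ : 0 < δ) {u : X} (hu : u ∈ C) :
    ∃ h, 0 < h ∧ h ≤ θ ∧ ‖G (u - h • G u) - G u‖ ≤ δ ∧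
      ∀ h', 0 < h' → h' ≤ θ → ‖G (u - h' • G u) - G u‖ ≤ δ → h' ≤ 2 * h := by
  set S : Set ℝ := {h | 0 < h ∧ h ≤ θ ∧ ‖G (u - h • G u) - G u‖ ≤ δ} with hS
  have hbdd : BddAbove S := ⟨θ, fun h hh => hh.2.1⟩
  obtain ⟨ρ, hρ, hcont⟩ := Metric.continuousOn_iff.1 hG u hu δ hδ
  obtain ⟨h₀, hh₀⟩ : S.Nonempty := by
    refine ⟨min θ (ρ / (2 * (‖G u‖ + 1))), by positivity, min_le_left _ _, ?_⟩
    have hmem := sub_smul_mem_of_le hC hθ (h := min θ (ρ / (2 * (‖G u‖ + 1)))) (by positivity)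
      (min_le_left _ _) hu (hin u hu)
    rw [← dist_eq_norm]
    refine (hcont _ hmem ?_).le
    rw [dist_eq_norm, sub_sub_cancel_left, norm_neg, norm_smul, Real.norm_of_nonneg (by positivity)]
    calc min θ (ρ / (2 * (‖G u‖ + 1))) * ‖G u‖ ≤ ρ / (2 * (‖G u‖ + 1)) * (‖G u‖ + 1) := by
          gcongr
          · exact min_le_right _ _
          · linarith
      _ = ρ / 2 := by field_simp
      _ < ρ := by linarith
  have hpos : 0 < sSup S := hh₀.1.trans_le (le_csSup hbdd hh₀)
  -- An admissible step above half the supremum; the supremum need not be attained, since membership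
  -- in `C` is all that `G` is controlled on.
  obtain ⟨h, hh, hlt⟩ := exists_lt_of_lt_csSup ⟨h₀, hh₀⟩ (half_lt_self hpos)
  refine ⟨h, hh.1, hh.2.1, hh.2.2, fun h' h1 h2 h3 => ?_⟩
  have := le_csSup hbdd (show h' ∈ S from ⟨h1, h2, h3⟩)
  linarith

/-- The explicit Euler scheme of a strongly accretive map runs for an infinite time. -/
theorem exists_euler_scheme [CompleteSpace X] (hCc : IsClosed C) (hC : Convex ℝ C)
    (hG : ContinuousOn G C)
    (hacc : ∀ u ∈ C, ∀ v ∈ C, ∀ h : ℝ, 0 < h → (1 + h) * ‖u - v‖ ≤ ‖u - v + h • (G u - G v)‖)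
    {θ δ r M : ℝ} (hθ : 0 < θ) (hin : ∀ u ∈ C, u - θ • G u ∈ C) (hδ : 0 < δ) {z₀ : X}
    (hz₀ : z₀ ∈ C) (hM : ∀ u ∈ C, ‖u - z₀‖ ≤ r → ‖G u‖ ≤ M) (hr : ‖G z₀‖ + δ ≤ r) :
    ∃ (z : ℕ → X) (h : ℕ → ℝ), z 0 = z₀ ∧ (∀ k, z k ∈ C) ∧ (∀ k, 0 < h k) ∧ (∀ k, h k ≤ θ) ∧
      (∀ k, z (k + 1) = z k - h k • G (z k)) ∧ (∀ k, ‖G (z (k + 1)) - G (z k)‖ ≤ δ) ∧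
      (∀ k, ‖z k - z₀‖ ≤ ‖G z₀‖ + δ) ∧ ¬ Summable h := by
  choose! step hpos hle hadm hmax using fun u (hu : u ∈ C) => exists_greedy_step hC hG hθ hin hδ hu
  let z : ℕ → X := fun k => Nat.rec z₀ (fun _ u => u - step u • G u) k
  have hzs : ∀ k, z (k + 1) = z k - step (z k) • G (z k) := fun k => rfl
  have hzC : ∀ k, z k ∈ C := by
    intro k
    induction k with
    | zero => exact hz₀
    | succ k ih =>
      rw [hzs]
      exact sub_smul_mem_of_le hC hθ (hpos _ ih).le (hle _ ih) ih (hin _ ih)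
  have hvar : ∀ k, ‖G (z (k + 1)) - G (z k)‖ ≤ δ := fun k => hadm _ (hzC k)
  have hball : ∀ k, ‖z k - z₀‖ ≤ ‖G z₀‖ + δ := by
    intro k
    induction k with
    | zero =>
      change ‖z₀ - z₀‖ ≤ _
      rw [sub_self, norm_zero]
      positivity
    | succ k ih =>
      have hh := hpos _ (hzC k)
      have h1 := hacc _ (hzC (k + 1)) _ hz₀ _ hh
      have h2 : z (k + 1) - z₀ + step (z k) • (G (z (k + 1)) - G z₀) =
          (z k - z₀) + step (z k) • ((G (z (k + 1)) - G (z k)) - G z₀) := by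
        rw [hzs]; module
      have h3 : ‖z (k + 1) - z₀ + step (z k) • (G (z (k + 1)) - G z₀)‖ ≤
          (‖G z₀‖ + δ) + step (z k) * (δ + ‖G z₀‖) := by
        rw [h2]
        refine (norm_add_le _ _).trans (add_le_add ih ?_)
        rw [norm_smul, Real.norm_of_nonneg hh.le]
        gcongr
        exact (norm_sub_le _ _).trans (by gcongr; exact hvar k)
      have h4 : 0 < 1 + step (z k) := by linarith
      refine le_of_mul_le_mul_left (h1.trans (h3.trans (le_of_eq ?_))) h4
      ring
  refine ⟨z, fun k => step (z k), rfl, hzC, fun k => hpos _ (hzC k), fun k => hle _ (hzC k), hzs,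
    hvar, hball, fun hsum => ?_⟩
  have hGM : ∀ k, ‖G (z k)‖ ≤ M := fun k => hM _ (hzC k) ((hball k).trans hr)
  have hM0 : 0 ≤ M := (norm_nonneg _).trans (hGM 0)
  -- If the total time were finite, the trajectory would converge to some `y`. Continuity of `G` at
  -- `y` makes one fixed step `h'` admissible late in the trajectory, so near-maximal steps could
  -- not tend to `0`.
  have hcauchy : CauchySeq z := by
    refine cauchySeq_of_dist_le_of_summable (fun k => step (z k) * M) (fun k => ?_)
      (hsum.mul_right M)
    rw [dist_eq_norm, Nat.succ_eq_add_one, hzs, sub_sub_cancel, norm_smul,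
      Real.norm_of_nonneg (hpos _ (hzC k)).le]
    have := (hpos _ (hzC k)).le
    gcongr
    exact hGM k
  obtain ⟨y, hy⟩ := cauchySeq_tendsto_of_complete hcauchy
  have hyC : y ∈ C := hCc.mem_of_tendsto hy (Eventually.of_forall hzC)
  obtain ⟨ρ, hρ, hcont⟩ := Metric.continuousOn_iff.1 hG y hyC (δ / 2) (by positivity)
  set h' := min θ (ρ / (4 * (M + 1))) with hh'
  have hh'0 : 0 < h' := by positivity
  have hev1 := Metric.tendsto_nhds.1 hy (ρ / 2) (by positivity)
  have hev2 := (Metric.tendsto_nhds.1 hsum.tendsto_atTop_zero (h' / 2) (by positivity))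
  obtain ⟨k, hk1, hk2⟩ := (hev1.and hev2).exists
  have hstep0 := hpos _ (hzC k)
  rw [Real.dist_eq, sub_zero, abs_of_pos hstep0] at hk2
  have hmem := sub_smul_mem_of_le hC hθ hh'0.le (min_le_left _ _) (hzC k) (hin _ (hzC k))
  have hmove : dist (z k - h' • G (z k)) (z k) ≤ ρ / 4 := by
    rw [dist_eq_norm, sub_sub_cancel_left, norm_neg, norm_smul, Real.norm_of_nonneg hh'0.le]
    calc h' * ‖G (z k)‖ ≤ ρ / (4 * (M + 1)) * (M + 1) := by
          gcongr
          · exact min_le_right _ _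
          · linarith [hGM k]
      _ = ρ / 4 := by field_simp
  have h1 := hcont _ hmem (by
    have := dist_triangle (z k - h' • G (z k)) (z k) y
    linarith)
  have h2 := hcont _ (hzC k) (by linarith)
  have h3 := hmax _ (hzC k) h' hh'0 (min_le_left _ _) (by
    rw [← dist_eq_norm]
    have := dist_triangle_right (G (z k - h' • G (z k))) (G (z k)) (G y)
    linarith)
  linarith

/-- Convexity of the squared norm along a segment. It links the shift length `q`, where smoothness
is used, with the Euler step `h`, where accretivity is used. -/
theorem convex_sq_norm_sub_smul_le {h q : ℝ} (hh : 0 ≤ h) (hq : 0 < q) (hhq : h ≤ q) (w v : X) :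
    q * ‖w - h • v‖ ^ 2 ≤ (q - h) * ‖w‖ ^ 2 + h * ‖w - q • v‖ ^ 2 := by
  have h1 : q * ‖w - h • v‖ ≤ (q - h) * ‖w‖ + h * ‖w - q • v‖ := by
    have h2 : q • (w - h • v) = (q - h) • w + h • (w - q • v) := by module
    have h3 : ‖q • (w - h • v)‖ ≤ ‖(q - h) • w‖ + ‖h • (w - q • v)‖ := by
      rw [h2]; exact norm_add_le _ _
    rwa [norm_smul, norm_smul, norm_smul, Real.norm_of_nonneg hq.le,
      Real.norm_of_nonneg (sub_nonneg.2 hhq), Real.norm_of_nonneg hh] at h3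
  have h4 : (q * ‖w - h • v‖) ^ 2 ≤ ((q - h) * ‖w‖ + h * ‖w - q • v‖) ^ 2 := by gcongr
  have h5 : 0 ≤ (q - h) * h * (‖w‖ - ‖w - q • v‖) ^ 2 := by
    have := sub_nonneg.2 hhq
    positivity
  refine le_of_mul_le_mul_left ?_ hq
  nlinarith

/-- A single Euler step and the squared distance to a point moved against `G`. -/
theorem sq_norm_sub_shift_le_of_euler_step {τ : ℝ → ℝ} (hτ : IsSmoothnessModulus X τ)
    (hacc : ∀ u ∈ C, ∀ v ∈ C, ∀ h : ℝ, 0 < h → (1 + h) * ‖u - v‖ ≤ ‖u - v + h • (G u - G v)‖)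
    {e κ q s D h : ℝ} (he : 0 < e) (hκ : 0 < κ) (hq1 : q ≤ 1) (hqκ : q * D ≤ τ e * κ)
    (hh : 0 < h) (hhs : h ≤ s) (hsq : s ≤ q) (hsD : s ≤ D) {y u u' : X} (hy : y ∈ C)
    (hu' : u' ∈ C) (hstep : u' = u - h • G u) (hvar : ‖G u' - G u‖ ≤ s) (hGu : ‖G u‖ ≤ D)
    (hGy : ‖G y‖ ≤ D) (huy : ‖u - y‖ ≤ D) (huy' : ‖u' - y‖ ≤ D) :
    h * ‖u - (y - q • G y)‖ ^ 2 ≤ (1 - 2 * q) * (h * ‖u - y‖ ^ 2) +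
      q * (‖u - y‖ ^ 2 - ‖u' - y‖ ^ 2) +
      q * ((2 * e * D ^ 2 + 4 * κ * D + 2 * q * D ^ 2 + s * (4 * D ^ 2 + 5 * D)) * h) := by
  have hq : 0 < q := by linarith
  have hD : 0 ≤ D := (norm_nonneg _).trans hGu
  have hs : 0 ≤ s := by linarith
  have h1 := hτ.sq_norm_sub_add_le he hκ hq.le hqκ huy hGy
  have h2 := convex_sq_norm_sub_smul_le hh.le hq (hhs.trans hsq) (u - y) (G y)
  have h3 := hacc u' hu' y hy h hh
  -- The explicit step is an implicit one up to the variation of `G`, which is at most `s`.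
  have h4 : u' - y + h • (G u' - G y) = (u - y - h • G y) + h • (G u' - G u) := by
    rw [hstep]; module
  have h5 : (1 + h) * ‖u' - y‖ ≤ ‖u - y - h • G y‖ + h * s := by
    rw [h4] at h3
    refine h3.trans ((norm_add_le _ _).trans ?_)
    rw [norm_smul, Real.norm_of_nonneg hh.le]
    gcongr
  have h6 : ‖u - y - h • G y‖ ≤ 2 * D := by
    refine (norm_sub_le _ _).trans ?_
    rw [norm_smul, Real.norm_of_nonneg hh.le]
    have : h * ‖G y‖ ≤ 1 * D := by gcongr; linarith
    linarith
  have h7 : ‖u - y‖ ≤ ‖u' - y‖ + h * D := by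
    have h8 : u - y = (u' - y) + h • G u := by rw [hstep]; abel
    rw [h8]
    refine (norm_add_le _ _).trans ?_
    rw [norm_smul, Real.norm_of_nonneg hh.le]
    gcongr
  rw [sub_sub_eq_add_sub, add_sub_right_comm]
  set a := ‖u - y + q • G y‖
  set p := ‖u - y - q • G y‖
  set f := ‖u - y - h • G y‖
  set d := ‖u - y‖
  set d' := ‖u' - y‖
  have hd : 0 ≤ d := norm_nonneg _
  have hd' : 0 ≤ d' := norm_nonneg _
  have hf : 0 ≤ f := norm_nonneg _
  have h8 : (1 + 2 * h) * d' ^ 2 ≤ f ^ 2 + 5 * D * s * h := by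
    have h9 : ((1 + h) * d') ^ 2 ≤ (f + h * s) ^ 2 := by gcongr
    have h10 : f * (h * s) ≤ 2 * D * (h * s) := by gcongr
    have h11 : (h * s) * (h * s) ≤ (1 * D) * (h * s) := by gcongr; linarith
    have h12 : 0 ≤ h ^ 2 * d' ^ 2 := by positivity
    nlinarith
  have h9 : d ^ 2 ≤ d' ^ 2 + 2 * D ^ 2 * s := by
    have h10 : (d - d') * (d + d') ≤ (h * D) * (d + d') := by gcongr; linarith
    have h11 : (h * D) * (d + d') ≤ (s * D) * (D + D) := by gcongr
    linarith
  have h10 : q * h * d ^ 2 ≤ q * h * (d' ^ 2 + 2 * D ^ 2 * s) := by gcongr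
  have h11 := mul_le_mul_of_nonneg_left h8 hq.le
  have h12 := mul_le_mul_of_nonneg_left h1 hh.le
  linarith

/-- For a strongly accretive map there are means of squared distances, along trajectories, that
nearly decrease when a point is moved against the map. -/
theorem exists_trajectory_mean [CompleteSpace X] {τ : ℝ → ℝ} (hτ : IsSmoothnessModulus X τ)
    (hCc : IsClosed C) (hC : Convex ℝ C) (hG : ContinuousOn G C)
    (hacc : ∀ u ∈ C, ∀ v ∈ C, ∀ h : ℝ, 0 < h → (1 + h) * ‖u - v‖ ≤ ‖u - v + h • (G u - G v)‖)
    {θ r M : ℝ} (hθ : 0 < θ) (hin : ∀ u ∈ C, u - θ • G u ∈ C) (hr : 0 < r) (hrM : r ≤ M) {z₀ : X}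
    (hz₀ : z₀ ∈ C) (hM : ∀ u ∈ C, ‖u - z₀‖ ≤ r → ‖G u‖ ≤ M) (hGz₀ : ‖G z₀‖ ≤ r / 8)
    {s : ℝ} (hs : 0 < s) (hsr : s ≤ r / 8) :
    ∃ V : X → ℝ, (∀ y, 0 ≤ V y) ∧ V z₀ ≤ (r / 4) ^ 2 ∧
      (∀ y y', ‖y - y'‖ ^ 2 ≤ 2 * V y + 2 * V y') ∧
      (∀ y y', V y' ≤ 2 * V y + 2 * ‖y - y'‖ ^ 2) ∧
      (∀ e κ q : ℝ, 0 < e → 0 < κ → q ≤ 1 → q * M ≤ τ e * κ → s ≤ q →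
        ∀ y ∈ C, ‖y - z₀‖ ≤ r / 2 → V (y - q • G y) ≤ (1 - 2 * q) * V y +
          q * (2 * e * M ^ 2 + 4 * κ * M + 2 * q * M ^ 2 + s * (5 * M ^ 2 + 5 * M))) ∧
      (∀ ε ρ : ℝ, 0 ≤ ε → 0 < ρ → ∀ y ∈ C, (∀ v ∈ C, ‖v - y‖ < ρ → ‖G v - G y‖ ≤ ε) →
        ‖G y‖ ≤ ε + (M + ‖G y‖) / ρ ^ 2 * V y + r / 4 * s) := by
  obtain ⟨z, h, hz0, hzC, hpos, hle, hstep, hvar, hball, hsum⟩ :=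
    exists_euler_scheme hCc hC hG hacc (θ := min θ s) (by positivity)
      (fun u hu => sub_smul_mem_of_le hC hθ (by positivity) (min_le_left _ _) hu (hin u hu)) hs hz₀
      hM (by linarith)
  have hhs : ∀ k, h k ≤ s := fun k => (hle k).trans (min_le_right _ _)
  have hball' : ∀ k, ‖z k - z₀‖ ≤ r / 4 := fun k => (hball k).trans (by linarith)
  have hGz : ∀ k, ‖G (z k)‖ ≤ M := fun k => hM _ (hzC k) ((hball' k).trans (by linarith))
  have htends := (not_summable_iff_tendsto_nat_atTop_of_nonneg fun k => (hpos k).le).1 hsum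
  -- Running for time at least `1 / s` makes boundary terms of order `s` after division by `H`.
  obtain ⟨n, hn⟩ := (htends.eventually_ge_atTop (1 / s)).exists
  set H := ∑ k ∈ Finset.range n, h k with hH
  have hH0 : 0 < H := lt_of_lt_of_le (by positivity) hn
  have hHs : 1 ≤ s * H := by rwa [div_le_iff₀' hs] at hn
  set W : X → ℝ := fun y => ∑ k ∈ Finset.range n, h k * ‖z k - y‖ ^ 2 with hW
  have hWmono : ∀ (c : ℝ) (f : ℕ → ℝ), (∀ k, f k ≤ c) →
      ∑ k ∈ Finset.range n, h k * f k ≤ c * H := by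
    intro c f hf
    rw [hH, Finset.mul_sum]
    refine Finset.sum_le_sum fun k _ => ?_
    rw [mul_comm c]
    have := (hpos k).le
    gcongr
    exact hf k
  refine ⟨fun y => W y / H, fun y => ?_, ?_, fun y y' => ?_, fun y y' => ?_, ?_, ?_⟩
  · have : 0 ≤ W y := Finset.sum_nonneg fun k _ => by have := (hpos k).le; positivity
    positivity
  · rw [div_le_iff₀ hH0]
    exact hWmono _ _ fun k => by have := hball' k; gcongr
  · have h1 : ‖y - y'‖ ^ 2 * H ≤ 2 * W y + 2 * W y' := by
      rw [hH, hW, Finset.mul_sum, Finset.mul_sum, Finset.mul_sum, ← Finset.sum_add_distrib]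
      refine Finset.sum_le_sum fun k _ => ?_
      have h2 : ‖y - y'‖ ≤ ‖z k - y‖ + ‖z k - y'‖ := by
        rw [← sub_sub_sub_cancel_left y' y (z k), norm_sub_rev]
        exact norm_sub_le _ _
      have h3 : ‖y - y'‖ ^ 2 ≤ (‖z k - y‖ + ‖z k - y'‖) ^ 2 := by gcongr
      have h4 : ‖y - y'‖ ^ 2 ≤ 2 * ‖z k - y‖ ^ 2 + 2 * ‖z k - y'‖ ^ 2 := by
        nlinarith [sq_nonneg (‖z k - y‖ - ‖z k - y'‖)]
      have := mul_le_mul_of_nonneg_left h4 (hpos k).le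
      linarith
    have h2 : ‖y - y'‖ ^ 2 ≤ (2 * W y + 2 * W y') / H := by rwa [le_div_iff₀ hH0]
    calc _ ≤ _ := h2
      _ = _ := by ring
  · have h1 : W y' ≤ 2 * W y + 2 * ‖y - y'‖ ^ 2 * H := by
      rw [hH, hW, Finset.mul_sum, Finset.mul_sum, ← Finset.sum_add_distrib]
      refine Finset.sum_le_sum fun k _ => ?_
      have h2 : ‖z k - y'‖ ≤ ‖z k - y‖ + ‖y - y'‖ := by
        rw [← sub_add_sub_cancel (z k) y y']
        exact norm_add_le _ _
      have h3 : ‖z k - y'‖ ^ 2 ≤ (‖z k - y‖ + ‖y - y'‖) ^ 2 := by gcongr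
      have h4 : ‖z k - y'‖ ^ 2 ≤ 2 * ‖z k - y‖ ^ 2 + 2 * ‖y - y'‖ ^ 2 := by
        nlinarith [sq_nonneg (‖z k - y‖ - ‖y - y'‖)]
      have := mul_le_mul_of_nonneg_left h4 (hpos k).le
      linarith
    rw [div_le_iff₀ hH0]
    calc W y' ≤ _ := h1
      _ = _ := by field_simp
  · intro e κ q he hκ hq1 hqκ hsq y hy hyz
    have hq : 0 < q := hs.trans_le hsq
    have hM0 : 0 < M := hr.trans_le hrM
    have hzy : ∀ k, ‖z k - y‖ ≤ M := by
      intro k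
      have h1 := norm_sub_le (z k - z₀) (y - z₀)
      rw [sub_sub_sub_cancel_right] at h1
      linarith [hball' k]
    have hGy : ‖G y‖ ≤ M := hM y hy (by linarith)
    set E := 2 * e * M ^ 2 + 4 * κ * M + 2 * q * M ^ 2 + s * (4 * M ^ 2 + 5 * M) with hE
    -- The differences of squared distances over single steps telescope.
    have h1 : W (y - q • G y) ≤ (1 - 2 * q) * W y + q * (‖z 0 - y‖ ^ 2 - ‖z n - y‖ ^ 2) +
        q * (E * H) := by
      rw [← Finset.sum_range_sub' (fun k => ‖z k - y‖ ^ 2) n, hW, hH]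
      simp only [Finset.mul_sum]
      rw [← Finset.sum_add_distrib, ← Finset.sum_add_distrib]
      refine Finset.sum_le_sum fun k _ => ?_
      exact sq_norm_sub_shift_le_of_euler_step hτ hacc he hκ hq1 hqκ (hpos k) (hhs k) hsq
        (by linarith) hy (hzC (k + 1)) (hstep k) (hvar k) (hGz k) hGy (hzy k) (hzy (k + 1))
    have h2 : ‖z 0 - y‖ ^ 2 ≤ M ^ 2 * (s * H) := by
      calc ‖z 0 - y‖ ^ 2 ≤ M ^ 2 * 1 := by rw [mul_one]; have := hzy 0; gcongr
        _ ≤ _ := by gcongr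
    have h3 : q * (‖z 0 - y‖ ^ 2 - ‖z n - y‖ ^ 2) ≤ q * (M ^ 2 * (s * H)) := by
      have := sq_nonneg ‖z n - y‖
      gcongr
      linarith
    rw [div_le_iff₀ hH0]
    have h4 : (1 - 2 * q) * (W y / H) * H = (1 - 2 * q) * W y := by field_simp
    rw [add_mul, h4]
    calc W (y - q • G y) ≤ _ := h1
      _ ≤ (1 - 2 * q) * W y + q * (M ^ 2 * (s * H)) + q * (E * H) := by linarith
      _ = _ := by rw [hE]; ring
  · intro ε ρ hε hρ y hy hnear
    have h1 : ∀ k, ‖G y - G (z k)‖ ≤ ε + (M + ‖G y‖) / ρ ^ 2 * ‖z k - y‖ ^ 2 := by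
      intro k
      have hM0 : 0 < M := hr.trans_le hrM
      rcases lt_or_ge ‖z k - y‖ ρ with hlt | hge
      · rw [norm_sub_rev]
        have : 0 ≤ (M + ‖G y‖) / ρ ^ 2 * ‖z k - y‖ ^ 2 := by positivity
        linarith [hnear _ (hzC k) hlt]
      · calc ‖G y - G (z k)‖ ≤ ‖G y‖ + ‖G (z k)‖ := norm_sub_le _ _
          _ ≤ ‖G y‖ + M := by gcongr; exact hGz k
          _ = (M + ‖G y‖) / ρ ^ 2 * ρ ^ 2 := by field_simp; ring
          _ ≤ (M + ‖G y‖) / ρ ^ 2 * ‖z k - y‖ ^ 2 := by gcongr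
          _ ≤ _ := by linarith
    -- The weighted sum of `G (z k)` is the bounded displacement `z 0 - z n`, so `G y` is small if
    -- the trajectory is mostly near `y`.
    have h2 : H • G y = (z 0 - z n) + ∑ k ∈ Finset.range n, h k • (G y - G (z k)) := by
      rw [← Finset.sum_range_sub' z n, hH, Finset.sum_smul, ← Finset.sum_add_distrib]
      refine Finset.sum_congr rfl fun k _ => ?_
      rw [hstep]
      module
    have h3 : H * ‖G y‖ ≤ r / 4 * (s * H) + (ε * H + (M + ‖G y‖) / ρ ^ 2 * W y) := by
      calc H * ‖G y‖ = ‖H • G y‖ := by rw [norm_smul, Real.norm_of_nonneg hH0.le]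
        _ ≤ ‖z 0 - z n‖ + ∑ k ∈ Finset.range n, ‖h k • (G y - G (z k))‖ := by
          rw [h2]
          exact (norm_add_le _ _).trans (by gcongr; exact norm_sum_le _ _)
        _ ≤ r / 4 * (s * H) + ∑ k ∈ Finset.range n,
            (ε * h k + (M + ‖G y‖) / ρ ^ 2 * (h k * ‖z k - y‖ ^ 2)) := by
          gcongr with k _
          · calc ‖z 0 - z n‖ ≤ r / 4 * 1 := by rw [hz0, norm_sub_rev, mul_one]; exact hball' n
              _ ≤ _ := by gcongr
          · rw [norm_smul, Real.norm_of_nonneg (hpos k).le]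
            have := mul_le_mul_of_nonneg_left (h1 k) (hpos k).le
            linarith
        _ = _ := by rw [Finset.sum_add_distrib, ← Finset.mul_sum, ← Finset.mul_sum]
    have h4 : (M + ‖G y‖) / ρ ^ 2 * (W y / H) * H = (M + ‖G y‖) / ρ ^ 2 * W y := by
      field_simp
    refine le_of_mul_le_mul_right ?_ hH0
    rw [add_mul, add_mul, h4]
    linarith

end Zeros

/-! ### Zeros of strongly accretive maps and resolvents of pseudocontractions -/

section StronglyAccretive

open Filter Topology

variable {X : Type*} [NormedAddCommGroup X] [NormedSpace ℝ X] {C : Set X}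

/-- A continuous strongly accretive map that satisfies an inwardness condition has a zero close to
any point at which it is small. -/
theorem exists_zero_of_stronglyAccretive [CompleteSpace X] {G : X → X} {τ : ℝ → ℝ}
    (hτ : IsSmoothnessModulus X τ) (hCc : IsClosed C) (hC : Convex ℝ C) (hG : ContinuousOn G C)
    (hacc : ∀ u ∈ C, ∀ v ∈ C, ∀ h : ℝ, 0 < h → (1 + h) * ‖u - v‖ ≤ ‖u - v + h • (G u - G v)‖)
    {θ r M : ℝ} (hθ : 0 < θ) (hin : ∀ u ∈ C, u - θ • G u ∈ C) (hr : 0 < r) (hrM : r ≤ M) {z₀ : X}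
    (hz₀ : z₀ ∈ C) (hM : ∀ u ∈ C, ‖u - z₀‖ ≤ r → ‖G u‖ ≤ M) (hGz₀ : ‖G z₀‖ ≤ r / 8) :
    ∃ z ∈ C, G z = 0 := by
  have hM0 : 0 < M := hr.trans_le hrM
  choose! V hV0 hVz hVdist hVnear hVstep hVzero using
    fun (s : ℝ) (hs : 0 < s ∧ s ≤ r / 8) =>
      exists_trajectory_mean hτ hCc hC hG hacc hθ hin hr hrM hz₀ hM hGz₀ hs.1 hs.2
  have hev : ∀ t : ℝ, 0 < t → ∀ᶠ s in 𝓝[>] (0 : ℝ), 0 < s ∧ s ≤ t := fun t ht =>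
    Ioc_mem_nhdsGT ht
  -- Upper bounds of the means in the limit `s → 0`. A positive infimum `m` is impossible: one shift
  -- from a near minimizer would fall below it.
  set P : Set ℝ := {a | ∃ y ∈ C, ‖y - z₀‖ ≤ r / 2 ∧ ∀ᶠ s in 𝓝[>] (0 : ℝ), V s y ≤ a} with hP
  have hP0 : ∀ a ∈ P, 0 ≤ a := by
    rintro a ⟨y, _, _, hy⟩
    obtain ⟨s, hs1, hs2⟩ := (hy.and (hev (r / 8) (by positivity))).exists
    exact (hV0 s hs2 y).trans hs1
  have hPne : (r / 4) ^ 2 ∈ P := by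
    refine ⟨z₀, hz₀, by rw [sub_self, norm_zero]; positivity, ?_⟩
    filter_upwards [hev (r / 8) (by positivity)] with s hs using hVz s hs
  have hbdd : BddBelow P := ⟨0, hP0⟩
  have hinf : sInf P = 0 := by
    refine le_antisymm ?_ (le_csInf ⟨_, hPne⟩ hP0)
    by_contra! hm
    set m := sInf P with hmdef
    have hmr : m ≤ (r / 4) ^ 2 := csInf_le hbdd hPne
    set e := m / (16 * M ^ 2) with he
    set κ := m / (32 * M) with hκ
    have he0 : 0 < e := by positivity
    have hκ0 : 0 < κ := by positivity
    have hτe := hτ.1 e he0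
    set q := min (min (1 / 2) θ) (min e (τ e * κ / M)) with hq
    have hq0 : 0 < q := by positivity
    have hq1 : q ≤ 1 / 2 := (min_le_left _ _).trans (min_le_left _ _)
    have hqθ : q ≤ θ := (min_le_left _ _).trans (min_le_right _ _)
    have hqe : q ≤ e := (min_le_right _ _).trans (min_le_left _ _)
    have hqκ : q * M ≤ τ e * κ := by
      rw [← le_div_iff₀ hM0]
      exact (min_le_right _ _).trans (min_le_right _ _)
    have heM : e * M ^ 2 = m / 16 := by rw [he]; field_simp
    have hκM : κ * M = m / 32 := by rw [hκ]; field_simp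
    have hqM : q * M ^ 2 ≤ m / 16 := by rw [← heM]; gcongr
    obtain ⟨a, ⟨y, hyC, hyz, hya⟩, ham⟩ := exists_lt_of_csInf_lt ⟨_, hPne⟩
      (show sInf P < m + q * m / 2 by rw [← hmdef]; have : 0 < q * m := by positivity
                                      linarith)
    have hyM : ‖G y‖ ≤ M := hM y hyC (by linarith)
    set y' := y - q • G y with hy'
    set a' := m - q * m / 4 with ha'
    have hqm : 0 < q * m := by positivity
    have hev' : ∀ᶠ s in 𝓝[>] (0 : ℝ), V s y' ≤ a' := by
      filter_upwards [hya, hev (r / 8) (by positivity), hev q hq0,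
        hev (m / (8 * (5 * M ^ 2 + 5 * M))) (by positivity)] with s h1 h2 h3 h4
      have h5 := hVstep s h2 e κ q he0 hκ0 (by linarith) hqκ h3.2 y hyC hyz
      have h6 : s * (5 * M ^ 2 + 5 * M) ≤ m / 8 := by
        calc s * (5 * M ^ 2 + 5 * M) ≤ m / (8 * (5 * M ^ 2 + 5 * M)) * (5 * M ^ 2 + 5 * M) := by
              gcongr
              exact h4.2
          _ = m / 8 := by field_simp
      have h7 : (1 - 2 * q) * V s y ≤ (1 - 2 * q) * (m + q * m / 2) := by
        have : 0 ≤ 1 - 2 * q := by linarith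
        gcongr
        linarith
      have h8 : q * (2 * e * M ^ 2 + 4 * κ * M + 2 * q * M ^ 2 + s * (5 * M ^ 2 + 5 * M)) ≤
          q * (m / 8 + m / 8 + m / 8 + m / 8) := by
        gcongr
        · linarith
        · linarith
        · linarith
      have h9 : 0 ≤ q * (q * m) := by positivity
      nlinarith
    have hmem : a' ∈ P := by
      refine ⟨y', sub_smul_mem_of_le hC hθ hq0.le hqθ hyC (hin y hyC), ?_, hev'⟩
      obtain ⟨s, h1, h2⟩ := (hev'.and (hev (r / 8) (by positivity))).exists
      have h3 := hVdist s h2 y' z₀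
      have h4 := hVz s h2
      -- Both means are at most `(r / 4) ^ 2`, so the squared distance is at most `4 * (r / 4) ^ 2 =
      -- (r / 2) ^ 2`.
      refine le_of_sq_le_sq ?_ (by positivity)
      nlinarith
    have := csInf_le hbdd hmem
    linarith
  have hex : ∀ j : ℕ, ∃ y ∈ C, ∀ᶠ s in 𝓝[>] (0 : ℝ), V s y ≤ (1 / 4) ^ j := by
    intro j
    obtain ⟨a, ⟨y, hyC, _, hya⟩, ham⟩ := exists_lt_of_csInf_lt ⟨_, hPne⟩
      (show sInf P < (1 / 4) ^ j by rw [hinf]; positivity)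
    exact ⟨y, hyC, hya.mono fun s hs => hs.trans ham.le⟩
  choose y hyC hyV using hex
  -- Points with small means are close to each other, so no uniform convexity is needed for
  -- convergence.
  have hcauchy : CauchySeq y := by
    refine cauchySeq_of_le_geometric (1 / 2) 2 (by norm_num) fun j => ?_
    obtain ⟨s, ⟨h1, h2⟩, h3⟩ := (((hyV j).and (hyV (j + 1))).and (hev (r / 8) (by positivity))).exists
    rw [dist_eq_norm]
    refine le_of_sq_le_sq ?_ (by positivity)
    calc ‖y j - y (j + 1)‖ ^ 2 ≤ 2 * V s (y j) + 2 * V s (y (j + 1)) := hVdist s h3 _ _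
      _ ≤ 2 * (1 / 4) ^ j + 2 * (1 / 4) ^ (j + 1) := by gcongr
      _ ≤ 4 * (1 / 4) ^ j := by
        have : (0 : ℝ) < (1 / 4) ^ j := by positivity
        rw [pow_succ]
        linarith
      _ = (2 * (1 / 2) ^ j) ^ 2 := by
        rw [mul_pow, ← pow_mul, mul_comm j, pow_mul]
        norm_num
  obtain ⟨x, hx⟩ := cauchySeq_tendsto_of_complete hcauchy
  have hxC : x ∈ C := hCc.mem_of_tendsto hx (Eventually.of_forall hyC)
  have hxV : ∀ t : ℝ, 0 < t → ∀ᶠ s in 𝓝[>] (0 : ℝ), V s x ≤ t := by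
    intro t ht
    have h1 : Tendsto (fun j => 2 * (1 / 4 : ℝ) ^ j + 2 * ‖y j - x‖ ^ 2) atTop (𝓝 0) := by
      have h2 := (tendsto_pow_atTop_nhds_zero_of_lt_one (r := (1 / 4 : ℝ)) (by norm_num)
        (by norm_num)).const_mul 2
      have h3 := ((tendsto_iff_norm_sub_tendsto_zero.1 hx).pow 2).const_mul 2
      simpa using h2.add h3
    obtain ⟨j, hj⟩ := (h1.eventually_le_const ht).exists
    filter_upwards [hyV j, hev (r / 8) (by positivity)] with s h4 h5
    have := hVnear s h5 (y j) x
    linarith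
  refine ⟨x, hxC, ?_⟩
  rw [← norm_le_zero_iff]
  refine le_of_forall_pos_le_add fun ε hε => ?_
  obtain ⟨ρ, hρ, hcont⟩ := Metric.continuousOn_iff.1 hG x hxC (ε / 3) (by positivity)
  obtain ⟨s, ⟨h1, h2⟩, h3⟩ := (((hxV (ε / 3 / ((M + ‖G x‖) / ρ ^ 2)) (by positivity)).and
    (hev (ε / 3 / (r / 4)) (by positivity))).and (hev (r / 8) (by positivity))).exists
  have h4 := hVzero s h3 (ε / 3) ρ (by positivity) hρ x hxC fun v hv hvx => by
    have := hcont v hv (by rwa [dist_eq_norm])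
    rw [dist_eq_norm] at this
    exact this.le
  have h5 : (M + ‖G x‖) / ρ ^ 2 * V s x ≤ ε / 3 := by rwa [le_div_iff₀' (by positivity)] at h1
  have h6 : r / 4 * s ≤ ε / 3 := by
    have := h2.2
    rwa [le_div_iff₀' (by positivity)] at this
  linarith

/-- This is accretivity of `Id - T`, obtained from the pseudocontraction inequality at `l⁻¹` by
scaling with `l`. -/
theorem IsPseudocontraction.norm_sub_le_add_smul {T : X → X} (hT : IsPseudocontraction C T) {l : ℝ}
    (hl : 0 < l) {u v : X} (hu : u ∈ C) (hv : v ∈ C) :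
    ‖u - v‖ ≤ ‖u - v + l • ((u - T u) - (v - T v))‖ := by
  have h1 := hT.2 u hu v hv l⁻¹ (by positivity)
  have h2 : u - v + l • ((u - T u) - (v - T v)) =
      l • ((l⁻¹ + 1) • (u - v) - (T u - T v)) := by
    match_scalars <;> field_simp
    ring
  rw [h2, norm_smul, Real.norm_of_nonneg hl.le]
  calc ‖u - v‖ = l * (l⁻¹ * ‖u - v‖) := by field_simp
    _ ≤ _ := by gcongr

/-- Resolvents of continuous pseudocontractions exist (Martin, Deimling). -/
theorem IsPseudocontraction.exists_resolvent [CompleteSpace X] {τ : ℝ → ℝ}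
    (hτ : IsSmoothnessModulus X τ) (hCc : IsClosed C) (hC : Convex ℝ C) {T : X → X}
    (hT : IsPseudocontraction C T) (hTc : ContinuousOn T C) {l : ℝ} (hl : 0 ≤ l) {y : X}
    (hy : y ∈ C) : ∃ z ∈ C, z + l • (z - T z) = y := by
  have hFy : ∀ k : ℝ, 0 ≤ k → ∀ z ∈ C, z + k • (z - T z) = y → ‖z - T z‖ ≤ ‖y - T y‖ := by
    intro k hk z hz hzy
    rcases hk.eq_or_lt with rfl | hk
    · rw [zero_smul, add_zero] at hzy
      rw [hzy]
    · have h1 := hT.norm_sub_le_add_smul hk hz hy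
      have h2 : z - y = -(k • (z - T z)) := by rw [← hzy]; abel
      have h3 : z - y + k • ((z - T z) - (y - T y)) = -(k • (y - T y)) := by rw [h2]; module
      rw [h3, h2, norm_neg, norm_neg, norm_smul, norm_smul, Real.norm_of_nonneg hk.le] at h1
      exact le_of_mul_le_mul_left h1 hk
  have hlip : ∀ k k' : ℝ, 0 ≤ k → 0 ≤ k' → ∀ z ∈ C, ∀ z' ∈ C, z + k • (z - T z) = y →
      z' + k' • (z' - T z') = y → ‖z - z'‖ ≤ |k - k'| * ‖y - T y‖ := by
    intro k k' hk hk' z hz z' hz' hzy hzy'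
    have h1 : z - z' + k' • ((z - T z) - (z' - T z')) = (k' - k) • (z - T z) := by
      have : z = y - k • (z - T z) := by rw [← hzy]; abel
      have h' : z' = y - k' • (z' - T z') := by rw [← hzy']; abel
      calc _ = (z + k • (z - T z)) - (z' + k' • (z' - T z')) + (k' - k) • (z - T z) := by module
        _ = _ := by rw [hzy, hzy']; abel
    have h2 : ‖z - z'‖ ≤ ‖z - z' + k' • ((z - T z) - (z' - T z'))‖ := by
      rcases hk'.eq_or_lt with rfl | hk'
      · rw [zero_smul, add_zero]
      · exact hT.norm_sub_le_add_smul hk' hz hz'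
    rw [h1, norm_smul, Real.norm_eq_abs, abs_sub_comm] at h2
    refine h2.trans ?_
    gcongr
    exact hFy k hk z hz hzy
  set S : Set ℝ := {k | ∃ z ∈ C, z + k • (z - T z) = y} with hS
  suffices h : Set.Icc 0 l ⊆ S from h ⟨hl, le_rfl⟩
  -- Continuation in the index: solutions are Lipschitz in `k`, which gives closedness, and a
  -- solution at `k` is an approximate zero for slightly larger `k'`.
  refine IsClosed.Icc_subset_of_forall_exists_gt ?_ ⟨y, hy, by simp⟩ ?_
  · refine IsSeqClosed.isClosed fun k k₀ hk hk₀ => ?_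
    have hk₀mem : k₀ ∈ Set.Icc 0 l := isClosed_Icc.mem_of_tendsto hk₀
      (Eventually.of_forall fun n => (hk n).2)
    choose z hzC hz using fun n => (hk n).1
    have hcauchy : CauchySeq z := by
      rw [Metric.cauchySeq_iff']
      intro ε hε
      obtain ⟨N, hN⟩ := Metric.cauchySeq_iff'.1 hk₀.cauchySeq (ε / (‖y - T y‖ + 1))
        (by positivity)
      refine ⟨N, fun n hn => ?_⟩
      have h1 := hN n hn
      rw [Real.dist_eq, lt_div_iff₀ (by positivity)] at h1
      rw [dist_eq_norm]
      have h2 := hlip _ _ (hk n).2.1 (hk N).2.1 _ (hzC n) _ (hzC N) (hz n) (hz N)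
      have := abs_nonneg (k n - k N)
      linarith
    obtain ⟨z₀, hz₀⟩ := cauchySeq_tendsto_of_complete hcauchy
    have hz₀C : z₀ ∈ C := hCc.mem_of_tendsto hz₀ (Eventually.of_forall hzC)
    have hTz : Tendsto (fun n => T (z n)) atTop (𝓝 (T z₀)) :=
      (hTc z₀ hz₀C).tendsto.comp
        (tendsto_nhdsWithin_iff.2 ⟨hz₀, Eventually.of_forall hzC⟩)
    have hlim := hz₀.add (hk₀.smul (hz₀.sub hTz))
    simp only [hz] at hlim
    exact ⟨⟨z₀, hz₀C, (tendsto_nhds_unique tendsto_const_nhds hlim).symm⟩, hk₀mem⟩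
  · rintro k ⟨⟨z, hzC, hz⟩, hk0, _⟩ k₁ hk₁
    have hk₁' : k < k₁ := hk₁
    obtain ⟨r, hr, hcont⟩ := Metric.continuousOn_iff.1 hTc z hzC 1 one_pos
    set F := ‖z - T z‖ with hF
    have hF0 : 0 ≤ F := norm_nonneg _
    -- Chosen so that `‖G z‖ = (k' - k) * F` is at most an eighth of the radius `r / 2`.
    set k' := min k₁ (k + r / (16 * (F + 1))) with hk'
    have hkk' : k < k' := lt_min hk₁' (by have : 0 < r / (16 * (F + 1)) := by positivity
                                          linarith)
    have hk'0 : 0 < k' := hk0.trans_lt hkk'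
    set G : X → X := fun u => u + k' • (u - T u) - y with hG
    have hGz : G z = (k' - k) • (z - T z) := by rw [hG, ← hz]; module
    suffices hex : ∃ u ∈ C, G u = 0 by
      obtain ⟨u, huC, hu⟩ := hex
      exact ⟨k', ⟨u, huC, sub_eq_zero.1 hu⟩, hkk', min_le_left _ _⟩
    refine exists_zero_of_stronglyAccretive (G := G) (θ := 1 / (1 + k'))
      (r := r / 2) (M := r / 2 + (r + ‖z - y‖ + k' * (r + F + 1))) (z₀ := z) hτ hCc hC
      (by fun_prop) (fun u hu v hv h hh => ?_) (by positivity) (fun u hu => ?_) (by positivity)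
      (by have : 0 ≤ r + ‖z - y‖ + k' * (r + F + 1) := by positivity
          linarith) hzC (fun u hu huz => ?_) ?_
    · have h1 := hT.norm_sub_le_add_smul (l := h * k' / (1 + h)) (by positivity) hu hv
      have h2 : u - v + h • (G u - G v) =
          (1 + h) • (u - v + (h * k' / (1 + h)) • ((u - T u) - (v - T v))) := by
        have : 1 + h ≠ 0 := by positivity
        rw [hG]
        match_scalars <;> field_simp <;> ring
      rw [h2, norm_smul, Real.norm_of_nonneg (by positivity)]
      gcongr
    -- For this `θ` the inwardness condition holds because the point is a convex combination of `T
    -- u` and `y`.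
    · have h1 : u - (1 / (1 + k')) • G u = T u + (1 / (1 + k')) • (y - T u) := by
        have : 1 + k' ≠ 0 := by positivity
        rw [hG]
        match_scalars <;> field_simp <;> ring
      rw [h1]
      exact hC.add_smul_sub_mem (hT.1 hu) hy
        ⟨by positivity, by rw [div_le_one (by positivity)]; linarith⟩
    · have h1 := hcont u hu (by rw [dist_eq_norm]; linarith)
      rw [dist_eq_norm] at h1
      have h2 : G u = (u - z) + (z - y) + k' • ((u - z) + (z - T z) - (T u - T z)) := by
        rw [hG]; module
      have h3 : ‖G u‖ ≤ ‖u - z‖ + ‖z - y‖ + k' * (‖u - z‖ + F + ‖T u - T z‖) := by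
        rw [h2]
        refine (norm_add_le _ _).trans (add_le_add (norm_add_le _ _) ?_)
        rw [norm_smul, Real.norm_of_nonneg hk'0.le]
        gcongr
        exact (norm_sub_le _ _).trans (by gcongr; exact norm_add_le _ _)
      have h4 : k' * (‖u - z‖ + F + ‖T u - T z‖) ≤ k' * (r + F + 1) := by
        gcongr
        linarith
      linarith
    · rw [hGz, norm_smul, Real.norm_of_nonneg (by linarith)]
      have h1 : k' - k ≤ r / (16 * (F + 1)) := by
        have := min_le_right k₁ (k + r / (16 * (F + 1)))
        linarith
      calc (k' - k) * ‖z - T z‖ ≤ r / (16 * (F + 1)) * (F + 1) := by gcongr; linarith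
        _ = r / 2 / 8 := by field_simp; norm_num

end StronglyAccretive

/-! ### Transfer to pseudocontractions with a fixed point -/

theorem pseudocontraction_metastability {Θ : RateFunctional} (hΘ : IsResolventRate.{u} Θ)
    {X : Type u} [NormedAddCommGroup X] [NormedSpace ℝ X] [CompleteSpace X]
    {η τ : ℝ → ℝ} (hη : IsConvexityModulus X η) (hτ : IsSmoothnessModulus X τ) {C : Set X}
    (hCc : IsClosed C) (hC : Convex ℝ C) {T : X → X} (hT : IsPseudocontraction C T)
    (hTc : ContinuousOn T C) {x : X} (hx : x ∈ C) {c : ℝ → X}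
    (hc : ∀ t ∈ Set.Ioo (0 : ℝ) 1, c t ∈ C ∧ c t = t • T (c t) + (1 - t) • x) {p : X} (hp : p ∈ C)
    (hTp : T p = p) {b : ℕ} (hb : 0 < b) (hxp : ‖x - p‖ ≤ (b : ℝ) / 2) {t : ℕ → ℝ}
    (ht : ∀ n, t n ∈ Set.Ioo (0 : ℝ) 1) {ξ γ : ℕ → ℕ} (hγ : ∀ n, 0 < γ n)
    (hξ : ∀ n, ∀ m ≥ ξ n, 1 - 1 / ((n : ℝ) + 1) ≤ t m) (htγ : ∀ n, t n ≤ 1 - 1 / (γ n : ℝ)) {ε : ℝ}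
    (hε : 0 < ε) (g : ℕ → ℕ) :
    MetastableBy (fun n => c (t n)) ε g (Θ.tilde b η τ ξ γ ε g) := by
  set A : Set (X × X) := (fun u => (u, u - T u)) '' C with hA
  have hacc : IsAccretive A := by
    rintro l hl _ ⟨u, hu, rfl⟩ _ ⟨v, hv, rfl⟩
    exact hT.norm_sub_le_add_smul hl hu hv
  have hmem : ∀ l y z, IsResolvent A l y z ↔ z ∈ C ∧ z + l • (z - T z) = y := by
    intro l y z
    constructor
    · rintro ⟨w, ⟨u, hu, huw⟩, hz⟩
      obtain ⟨rfl, rfl⟩ := Prod.mk.inj huw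
      exact ⟨hu, hz⟩
    · rintro ⟨hz, hzy⟩
      exact ⟨z - T z, ⟨z, hz, rfl⟩, hzy⟩
  have hsub : ∀ n, 0 < 1 - t n := fun n => sub_pos.2 (ht n).2
  refine hΘ X η τ hη hτ (C ∩ Metric.closedBall p (b / 2)) (hCc.inter Metric.isClosed_closedBall)
    (hC.inter (convex_closedBall _ _)) b hb (fun y hy z hz => ?_) A hacc (fun l hl y hy => ?_)
    (fun l hl y hy z hz => ?_) x ⟨hx, by rwa [mem_closedBall_iff_norm]⟩ (fun n => t n / (1 - t n))
    (fun n => div_pos (ht n).1 (hsub n)) (fun n => ξ (n + 1)) γ hγ (fun n m hm => ?_) (fun n => ?_)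
    (fun n => c (t n)) (fun n => ?_) ε hε g
  · have h1 := mem_closedBall_iff_norm.1 hy.2
    have h2 := mem_closedBall_iff_norm.1 hz.2
    have h3 := norm_sub_le (y - p) (z - p)
    rw [sub_sub_sub_cancel_right] at h3
    linarith
  · obtain ⟨z, hz, hzy⟩ := hT.exists_resolvent hτ hCc hC hTc hl.le hy.1
    exact ⟨z, (hmem _ _ _).2 ⟨hz, hzy⟩⟩
  · obtain ⟨hzC, hzy⟩ := (hmem _ _ _).1 hz
    refine ⟨hzC, mem_closedBall_iff_norm.2 ?_⟩
    -- As `p` is a zero of `Id - T`, resolvents do not increase the distance to `p` and hence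
    -- preserve the ball.
    have h1 := hT.norm_sub_le_add_smul hl hzC hp
    have h2 : z - p + l • ((z - T z) - (p - T p)) = y - p := by
      rw [hTp, ← hzy]; module
    rw [h2] at h1
    exact h1.trans (mem_closedBall_iff_norm.1 hy.2)
  -- The shift of `ξ` is needed here: `t m ≥ 1 - 1 / (n + 2)` is equivalent to `t m / (1 - t m) ≥ n
  -- + 1`.
  · have h1 := hξ (n + 1) m hm
    have h2 := hsub m
    push_cast at h1
    have h3 : 1 - t m ≤ 1 / ((n : ℝ) + 1 + 1) := by linarith
    rw [le_div_iff₀ (by positivity)] at h3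
    rw [le_div_iff₀ h2]
    linarith
  · have h1 := htγ n
    have h2 : (0 : ℝ) < γ n := by exact_mod_cast hγ n
    have h3 : 1 / (γ n : ℝ) ≤ 1 - t n := by linarith
    rw [div_le_iff₀ h2] at h3
    rw [div_le_iff₀ (hsub n)]
    linarith [(ht n).2]
  · obtain ⟨h1, h2⟩ := hc _ (ht n)
    refine (hmem _ _ _).2 ⟨h1, ?_⟩
    have h3 := (hsub n).ne'
    have h4 : (1 - t n) • (c (t n) + (t n / (1 - t n)) • (c (t n) - T (c (t n)))) =
        (1 - t n) • x := by
      have h5 : (1 - t n) • (c (t n) + (t n / (1 - t n)) • (c (t n) - T (c (t n)))) =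
          c (t n) - t n • T (c (t n)) := by
        match_scalars <;> field_simp
        ring
      rw [h5, sub_eq_iff_eq_add', ← h2]
    exact smul_right_injective X h3 h4
theorem corollary4p4 :
    ∃ Θ : RateFunctional, TDefinable Θ ∧ IsResolventRate.{u} Θ ∧
      ∀ (X : Type u) [NormedAddCommGroup X] [NormedSpace ℝ X] [CompleteSpace X]
        (η τ : ℝ → ℝ), IsConvexityModulus X η → IsSmoothnessModulus X τ →
      ∀ C : Set X, IsClosed C → Convex ℝ C →
      ∀ T : X → X, IsPseudocontraction C T → ContinuousOn T C →
      ∀ x ∈ C, ∀ c : ℝ → X,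
        (∀ t ∈ Set.Ioo (0 : ℝ) 1, c t ∈ C ∧ c t = t • T (c t) + (1 - t) • x) →
      ∀ p ∈ C, T p = p → ∀ b : ℕ, 0 < b → ‖x - p‖ ≤ (b : ℝ) / 2 →
      ∀ t : ℕ → ℝ, (∀ n, t n ∈ Set.Ioo (0 : ℝ) 1) →
      ∀ ξ γ : ℕ → ℕ, (∀ n, 0 < γ n) →
        (∀ n, ∀ m ≥ ξ n, 1 - 1 / ((n : ℝ) + 1) ≤ t m) →
        (∀ n, t n ≤ 1 - 1 / (γ n : ℝ)) →
      ∀ ε : ℝ, 0 < ε → ∀ g : ℕ → ℕ,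
        ∃ N ≤ Θ.tilde b η τ ξ γ ε g,
          ∀ m ∈ Set.Icc N (N + g N), ∀ n ∈ Set.Icc N (N + g N),
            ‖c (t m) - c (t n)‖ ≤ ε := by
  refine ⟨resolventRate, tDefinable_resolventRate, isResolventRate_resolventRate, ?_⟩
  intro X _ _ _ η τ hη hτ C hCc hC T hT hTc x hx c hc p hp hTp b hb hxp t ht ξ γ hγ hξ htγ ε hε g
  exact pseudocontraction_metastability isResolventRate_resolventRate hη hτ hCc hC hT hTc hx hc hp
    hTp hb hxp ht hγ hξ htγ hε g
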